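/- Let $f$ and $g$ be probability densities on $\mathbb{R}$ with $f\le C'g$ for some finite constant $C'$, let $F$ and $G$ be their distribution functions, and let $C=\sup_{x}f(x)/g(x)$ (with $0/0=0$). For $0<u<1$ put $\tilde f(u)=f(G^{-1}(u))/g(G^{-1}(u))$, and assume that $\tilde f$ is Riemann-integrable on $(0,1)$. Let $\epsilon>0$ and consider the following algorithm, driven by independent unbiased random bits. Decision phase: start with the rectangle $R=[0,1]\times[0,C]$. If $R$ lies in $\{(u,v):v\le\tilde f(u)\}$ (over $0<u<1$), accept $R$. Otherwise, if $R$ lies in $\{(u,v):v\ge\tilde f(u)\}$, restart from $[0,1]\times[0,C]$. Otherwise use two bits to replace $R$ by one of its four congruent quadrants, chosen uniformly, and repeat. Inversion/bisection phase: when $R=[u_1,u_2]\times[v_1,v_2]$ has been accepted, as long as $G^{-1}(u_2)-G^{-1}(u_1)>2\epsilon$, use one bit to replace $[u_1,u_2]$ by its left or its right half; then halt with output $\frac12\big(G^{-1}(u_1)+G^{-1}(u_2)\big)$. Then the expected number of bits used by the inversion/bisection phase is not more than $$3+\sum_{j\in\mathbb{Z}}F(I_j)\log_2\frac{1}{F(I_j)},\qquad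 I_j=[2\epsilon j,2\epsilon(j+1)),\quad F([a,b))=F(b)-F(a).$$ If moreover this sum is finite for $\epsilon=1$ and $\int f\log_2(1/f)>-\infty$, then $f\log_2(1/f)$ is integrable and, as $\epsilon\downarrow0$, the displayed bound, and hence the expected number of bits, does not exceed $$\log_2\frac1\epsilon+\int f\log_2\frac1f+5+o(1).$$ -/

import Mathlib

namespace VonNeumann

open MeasureTheory Set

noncomputable section

/-- A probability density on the real line. -/
structure IsDensity (f : ℝ → ℝ) : Prop where
  nonneg : ∀ x, 0 ≤ f x
  integrable : Integrable f
  integral_eq_one : ∫ x, f x = 1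

/-- The distribution function of a density. -/
def cdf (f : ℝ → ℝ) (x : ℝ) : ℝ := ∫ t in Iic x, f t

/-- The inverse of the distribution function of `g` on `[0, 1]`. The values at the two ends are
the ends of the support of `g`, so they may be infinite. -/
def cdfInv (g : ℝ → ℝ) (u : ℝ) : EReal :=
  if u = 0 then sSup ((fun x : ℝ => (x : EReal)) '' {x | cdf g x = 0})
  else sInf ((fun x : ℝ => (x : EReal)) '' {x | u ≤ cdf g x})

/-- The rejection constant, the supremum of `f / g` (with `0 / 0 = 0`). -/
def rejConst (f g : ℝ → ℝ) : ℝ := ⨆ x, f x / g x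

/-- The transformed density `u ↦ f (G⁻¹ u) / g (G⁻¹ u)`, of interest for `0 < u < 1`. -/
def transformed (f g : ℝ → ℝ) (u : ℝ) : ℝ :=
  f (cdfInv g u).toReal / g (cdfInv g u).toReal

/-- Riemann integrability, in Darboux's form, of a function given on the open unit interval. -/
def RiemannIntegrableUnit (φ : ℝ → ℝ) : Prop :=
  (∃ M : ℝ, ∀ u ∈ Ioo (0 : ℝ) 1, |φ u| ≤ M) ∧
  ∀ δ : ℝ, 0 < δ → ∃ (n : ℕ) (t : ℕ → ℝ), Monotone t ∧ t 0 = 0 ∧ t n = 1 ∧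
    ∑ i ∈ Finset.range n, (t (i + 1) - t i) *
      (sSup (φ '' (Icc (t i) (t (i + 1)) ∩ Ioo 0 1)) -
        sInf (φ '' (Icc (t i) (t (i + 1)) ∩ Ioo 0 1))) < δ

/-- The closed rectangle `[u₁, u₂] × [v₁, v₂]`. -/
structure Rect where
  u₁ : ℝ
  u₂ : ℝ
  v₁ : ℝ
  v₂ : ℝ

namespace Rect

/-- The quadrant of a rectangle that is selected by two bits: the rectangle spanned by the center
and one vertex. -/
def child (R : Rect) (b : Bool × Bool) : Rect where
  u₁ := if b.1 then (R.u₁ + R.u₂) / 2 else R.u₁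
  u₂ := if b.1 then R.u₂ else (R.u₁ + R.u₂) / 2
  v₁ := if b.2 then (R.v₁ + R.v₂) / 2 else R.v₁
  v₂ := if b.2 then R.v₂ else (R.v₁ + R.v₂) / 2

/-- The rectangle lies below the graph of `φ` (over the open unit interval). -/
def Accepting (φ : ℝ → ℝ) (R : Rect) : Prop :=
  ∀ u ∈ Icc R.u₁ R.u₂ ∩ Ioo 0 1, ∀ v ∈ Icc R.v₁ R.v₂, v ≤ φ u

/-- The rectangle lies above the graph of `φ` (over the open unit interval). -/
def Rejecting (φ : ℝ → ℝ) (R : Rect) : Prop :=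
  ∀ u ∈ Icc R.u₁ R.u₂ ∩ Ioo 0 1, ∀ v ∈ Icc R.v₁ R.v₂, φ u ≤ v

end Rect

/-- The root `[0, 1] × [0, C]` of the quadtree. -/
def root (f g : ℝ → ℝ) : Rect := ⟨0, 1, 0, rejConst f g⟩

/-- The states of the rejection algorithm: the decision phase, at a rectangle of the quadtree;
the inversion/bisection phase, at an interval `[u₁, u₂]`; and halted, with an output. -/
inductive State where
  | decision (R : Rect)
  | bisection (u₁ u₂ : ℝ)
  | halted (x : ℝ)

/-- The halting test of the bisection phase: `G⁻¹ u₂ - G⁻¹ u₁ ≤ 2 ε`. -/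
def Short (g : ℝ → ℝ) (ε u₁ u₂ : ℝ) : Prop :=
  cdfInv g u₂ - cdfInv g u₁ ≤ ((2 * ε : ℝ) : EReal)

open Classical in
/-- One iteration of the rejection algorithm, given the random bits available to it.
In the decision phase an accepting rectangle starts the bisection of its projection, a rejecting
one restarts the algorithm at the root, and otherwise two bits select a quadrant.
The bisection phase either halts with the midpoint as output or uses one bit, `b.1`, to select
a half of the interval `[u₁, u₂]`. -/
def step (f g : ℝ → ℝ) (ε : ℝ) (b : Bool × Bool) : State → State
  | .decision R =>
      if R.Accepting (transformed f g) then .bisection R.u₁ R.u₂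
      else if R.Rejecting (transformed f g) then .decision (root f g)
      else .decision (R.child b)
  | .bisection u₁ u₂ =>
      if Short g ε u₁ u₂ then .halted (((cdfInv g u₁).toReal + (cdfInv g u₂).toReal) / 2)
      else if b.1 then .bisection ((u₁ + u₂) / 2) u₂
      else .bisection u₁ ((u₁ + u₂) / 2)
  | .halted x => .halted x

/-- The state of the algorithm before iteration number `n`, when iteration number `i` finds the
bits `ω i`. -/
def run (f g : ℝ → ℝ) (ε : ℝ) (ω : ℕ → Bool × Bool) : ℕ → State
  | 0 => .decision (root f g)
  | n + 1 => step f g ε (ω n) (run f g ε ω n)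

/-- The number of bits that the inversion/bisection phase uses in an iteration from a state. -/
def bisectionCost (g : ℝ → ℝ) (ε : ℝ) : State → ENNReal
  | .decision _ => 0
  | .bisection u₁ u₂ => open Classical in if Short g ε u₁ u₂ then 0 else 1
  | .halted _ => 0

/-- The number of bits used by the inversion/bisection phase. -/
def bisectionBits (f g : ℝ → ℝ) (ε : ℝ) (ω : ℕ → Bool × Bool) : ENNReal :=
  ∑' n, bisectionCost g ε (run f g ε ω n)

/-- The law of independent unbiased random bits, two for each iteration. -/
def fairBits : Measure (ℕ → Bool × Bool) :=
  Measure.infinitePi fun _ => (PMF.uniformOfFintype (Bool × Bool)).toMeasure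

/-- The expected number of bits used by the inversion/bisection phase. -/
def expectedBisectionBits (f g : ℝ → ℝ) (ε : ℝ) : ENNReal :=
  ∫⁻ ω, bisectionBits f g ε ω ∂fairBits

/-- The probability `F(I_j) = F(2ε(j+1)) - F(2εj)`. -/
def cellProb (f : ℝ → ℝ) (ε : ℝ) (j : ℤ) : ℝ :=
  cdf f (2 * ε * (j + 1)) - cdf f (2 * ε * j)

/-- The entropy `∑ j, F(I_j) log₂ (1 / F(I_j))`; every term is nonnegative. -/
def gridEntropy (f : ℝ → ℝ) (ε : ℝ) : ENNReal :=
  ∑' j : ℤ, ENNReal.ofReal (cellProb f ε j * Real.logb 2 (1 / cellProb f ε j))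

end

end VonNeumann

/-! Let Φ ≥ 0 be a function of the state such that the cost of an iteration plus the mean of Φ after
it is at most Φ. Then Φ bounds the expected total cost (`expectedBisectionBits_le`), whether or not
the algorithm halts. It therefore suffices to find such a `potential` with value at most E = 3 +
`gridEntropy f ε` at the root.

Bisection of [u₁, u₂], of length L: the distribution function of g carries the grid to cells (a, b]
that partition (0, 1). A cell of overlap l contributes l (log₂(L / l) + κ), with κ = 0, 2 or 3 by
relative position. An interval inside one cell passes the halting test. Otherwise the potentials of
the two halves sum to at most that of the interval minus L, which pays for one bit (`cellPot_step`,
`intervalPot_step`). Gibbs' inequality against the weights F(I_j) bounds the total by the integral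
over the interval of 3 + log₂(1 / F(I_j)), the path weight (`intervalPot_le`).

Decision at a rectangle: the potential is the mean over the rectangle of the path weight below the
graph and of E above it. It does not increase on average over quadrants, it dominates the bisection
potential on acceptance, and it equals E on rejection, enough for a restart. At the root, the change
of variables x = G⁻¹(u) turns the part below the graph into ∑ F(I_j)(3 + log₂(1 / F(I_j))) = E over
an area 1, so the mean is at most E (`rectMass_root_le`).

Asymptotics: Gibbs' inequality also bounds the grid entropy by log₂(1 / (2ε)) plus a cross entropy
relative to any positive q that varies slowly at scale ε (`gridEntropy_le_of_slowly_varying`). Here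
q averages a Laplace smoothing of f, whose cross entropy is finite because the grid entropy at ε = 1
is, and a continuous L¹ approximation of f. The losses sum to less than the available two bits. -/

namespace VonNeumann
open MeasureTheory Set Filter Topology
open scoped ENNReal

/-! ### The algorithm as a Markov chain, and superharmonic majorants -/

/-- The expectation of `h` after one iteration from the state `s`. -/
noncomputable def meanStep (f g : ℝ → ℝ) (ε : ℝ) (h : State → ℝ≥0∞) (s : State) : ℝ≥0∞ :=
  ∑ b : Bool × Bool, 4⁻¹ * h (step f g ε b s)

lemma meanStep_mono (f g : ℝ → ℝ) (ε : ℝ) {h k : State → ℝ≥0∞} {s : State}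
    (hk : ∀ b, h (step f g ε b s) ≤ k (step f g ε b s)) :
    meanStep f g ε h s ≤ meanStep f g ε k s := by
  unfold meanStep
  gcongr with b
  exact hk b

lemma meanStep_sum (f g : ℝ → ℝ) (ε : ℝ) (h : ℕ → State → ℝ≥0∞) (N : ℕ) (s : State) :
    meanStep f g ε (fun s => ∑ n ∈ Finset.range N, h n s) s =
      ∑ n ∈ Finset.range N, meanStep f g ε (h n) s := by
  unfold meanStep
  rw [Finset.sum_comm]
  simp_rw [Finset.mul_sum]

lemma run_congr (f g : ℝ → ℝ) (ε : ℝ) {ω ω' : ℕ → Bool × Bool} {n : ℕ}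
    (h : ∀ i < n, ω i = ω' i) : run f g ε ω n = run f g ε ω' n := by
  induction n with
  | zero => rfl
  | succ n ih =>
    simp only [run]
    rw [ih fun i hi => h i (hi.trans n.lt_succ_self), h n n.lt_succ_self]

/-- Extension of finitely many bits by arbitrary ones. -/
def extendBits (n : ℕ) (w : Finset.range n → Bool × Bool) (i : ℕ) : Bool × Bool :=
  if h : i ∈ Finset.range n then w ⟨i, h⟩ else (false, false)

lemma run_extendBits (f g : ℝ → ℝ) (ε : ℝ) (ω : ℕ → Bool × Bool) (n : ℕ) :
    run f g ε (extendBits n fun i => ω i) n = run f g ε ω n := by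
  apply run_congr
  intro i hi
  simp [extendBits, hi]

instance : IsProbabilityMeasure fairBits := by
  unfold fairBits
  infer_instance

/-- No σ-algebra on `State` is needed: the state before iteration n depends on finitely many bits,
so any function of it factors through a finite type. -/
lemma measurable_comp_run (f g : ℝ → ℝ) (ε : ℝ) (h : State → ℝ≥0∞) (n : ℕ) :
    Measurable fun ω => h (run f g ε ω n) := by
  have : (fun ω => h (run f g ε ω n)) =
      (fun w => h (run f g ε (extendBits n w) n)) ∘ fun ω (i : Finset.range n) => ω i := by
    ext ω
    simp [run_extendBits]
  rw [this]
  exact (measurable_of_finite _).comp (by fun_prop)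

lemma indepFun_bits (n : ℕ) :
    ProbabilityTheory.IndepFun (fun (ω : ℕ → Bool × Bool) (i : Finset.range n) => ω i)
      (fun ω => ω n) fairBits := by
  have h := ProbabilityTheory.iIndepFun_infinitePi (ι := ℕ)
    (P := fun _ => (PMF.uniformOfFintype (Bool × Bool)).toMeasure)
    (X := fun _ b => b) (fun _ => measurable_id)
  have h2 := h.indepFun_finset (Finset.range n) {n} (by simp) (fun i => by fun_prop)
  exact h2.comp (φ := id) 
    (ψ := fun w : ({n} : Finset ℕ) → Bool × Bool => w ⟨n, Finset.mem_singleton_self n⟩)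
    measurable_id (measurable_pi_apply _)

lemma fairBits_coord (n : ℕ) (b : Bool × Bool) : fairBits {ω | ω n = b} = 4⁻¹ := by
  have h := Measure.infinitePi_map_eval
    (fun _ : ℕ => (PMF.uniformOfFintype (Bool × Bool)).toMeasure) n
  have h2 : fairBits {ω | ω n = b} = (fairBits.map fun ω => ω n) {b} := by
    rw [Measure.map_apply (by fun_prop) (measurableSet_singleton b)]
    rfl
  rw [h2, fairBits, h, PMF.toMeasure_apply_singleton _ _ (measurableSet_singleton b)]
  norm_num

/-- The Markov property: the bits of iteration n are independent of the state before it. The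
integrand is split by the value b of these bits. -/
lemma lintegral_comp_run_succ (f g : ℝ → ℝ) (ε : ℝ) (h : State → ℝ≥0∞) (n : ℕ) :
    ∫⁻ ω, h (run f g ε ω (n + 1)) ∂fairBits =
      ∫⁻ ω, meanStep f g ε h (run f g ε ω n) ∂fairBits := by
  have key : ∀ b : Bool × Bool,
      ∫⁻ ω, ({b} : Set (Bool × Bool)).indicator 1 (ω n) * h (step f g ε b (run f g ε ω n))
        ∂fairBits = ∫⁻ ω, 4⁻¹ * h (step f g ε b (run f g ε ω n)) ∂fairBits := by
    intro b
    have hm := measurable_comp_run f g ε (fun s => h (step f g ε b s)) n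
    have hi : ProbabilityTheory.IndepFun
        (fun ω : ℕ → Bool × Bool => ({b} : Set (Bool × Bool)).indicator (1 : Bool × Bool → ℝ≥0∞) (ω n))
        (fun ω => h (step f g ε b (run f g ε ω n))) fairBits := by
      have := ((indepFun_bits n).comp (φ := fun w => h (step f g ε b (run f g ε (extendBits n w) n)))
        (ψ := ({b} : Set (Bool × Bool)).indicator (1 : Bool × Bool → ℝ≥0∞))
        (measurable_of_finite _) (measurable_of_finite _)).symm
      have he : (fun ω => h (step f g ε b (run f g ε ω n))) =
          (fun w => h (step f g ε b (run f g ε (extendBits n w) n))) ∘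
            fun ω (i : Finset.range n) => ω i := by
        ext ω
        simp only [Function.comp, run_extendBits]
      rw [he]
      exact this
    have hmi : Measurable fun ω : ℕ → Bool × Bool =>
        ({b} : Set (Bool × Bool)).indicator (1 : Bool × Bool → ℝ≥0∞) (ω n) :=
      (measurable_of_finite (({b} : Set (Bool × Bool)).indicator 1)).comp (measurable_pi_apply n)
    have := ProbabilityTheory.lintegral_mul_eq_lintegral_mul_lintegral_of_indepFun hmi hm hi
    simp only [Pi.mul_apply] at this
    rw [this, lintegral_const_mul _ hm]
    congr 1
    have hset : (fun ω : ℕ → Bool × Bool =>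
        ({b} : Set (Bool × Bool)).indicator (1 : Bool × Bool → ℝ≥0∞) (ω n)) =
        {ω : ℕ → Bool × Bool | ω n = b}.indicator 1 := by
      ext ω
      simp [indicator]
    rw [hset, lintegral_indicator_one, fairBits_coord]
    exact measurableSet_eq_fun (measurable_pi_apply n) measurable_const
  unfold meanStep
  rw [lintegral_finsetSum _ fun b _ =>
    (measurable_comp_run f g ε (fun s => h (step f g ε b s)) n).const_mul _]
  simp_rw [← key]
  rw [← lintegral_finsetSum]
  · congr 1
    ext ω
    simp [indicator, run]
  · intro b _
    exact Measurable.mul ((measurable_of_finite (({b} : Set (Bool × Bool)).indicator 1)).comp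
      (measurable_pi_apply n)) (measurable_comp_run f g ε (fun s => h (step f g ε b s)) n)

lemma lintegral_comp_run (f g : ℝ → ℝ) (ε : ℝ) (h : State → ℝ≥0∞) (n : ℕ) :
    ∫⁻ ω, h (run f g ε ω n) ∂fairBits =
      (meanStep f g ε)^[n] h (.decision (root f g)) := by
  induction n generalizing h with
  | zero => simp [run]
  | succ n ih => rw [lintegral_comp_run_succ, ih, Function.iterate_succ_apply]

/-- A superharmonic majorant of the cost bounds the expected total cost. -/
lemma sum_iterate_meanStep_le (f g : ℝ → ℝ) (ε : ℝ) {Φ : State → ℝ≥0∞} {P : State → Prop}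
    (hP : ∀ s, P s → ∀ b, P (step f g ε b s))
    (hΦ : ∀ s, P s → bisectionCost g ε s + meanStep f g ε Φ s ≤ Φ s) (N : ℕ) :
    ∀ s, P s → ∑ n ∈ Finset.range N, (meanStep f g ε)^[n] (bisectionCost g ε) s ≤ Φ s := by
  induction N with
  | zero => simp
  | succ N ih =>
    intro s hs
    -- The cost of the current state is split off; the remaining N costs are a one-step mean of the
    -- sum bounded by induction.
    rw [Finset.sum_range_succ']
    simp_rw [Function.iterate_succ_apply', ← meanStep_sum]
    rw [add_comm]
    refine le_trans ?_ (hΦ s hs)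
    gcongr
    · exact le_rfl
    · exact meanStep_mono f g ε fun b => ih _ (hP s hs b)

lemma expectedBisectionBits_le (f g : ℝ → ℝ) (ε : ℝ) {Φ : State → ℝ≥0∞} {P : State → Prop}
    (hP : ∀ s, P s → ∀ b, P (step f g ε b s))
    (hΦ : ∀ s, P s → bisectionCost g ε s + meanStep f g ε Φ s ≤ Φ s)
    (hroot : P (.decision (root f g))) :
    expectedBisectionBits f g ε ≤ Φ (.decision (root f g)) := by
  unfold expectedBisectionBits bisectionBits
  rw [lintegral_tsum fun n => (measurable_comp_run f g ε _ n).aemeasurable]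
  simp_rw [lintegral_comp_run]
  exact ENNReal.tsum_le_of_sum_range_le fun N => sum_iterate_meanStep_le f g ε hP hΦ N _ hroot

/-! ### The potential of one cell under bisection -/

/-- The length of the intersection of `[a, b]` and `[u₁, u₂]`. -/
noncomputable def overlap (a b u₁ u₂ : ℝ) : ℝ := max 0 (min b u₂ - max a u₁)

lemma overlap_nonneg (a b u₁ u₂ : ℝ) : 0 ≤ overlap a b u₁ u₂ := le_max_left _ _

lemma overlap_le {a b u₁ u₂ : ℝ} (h : u₁ ≤ u₂) : overlap a b u₁ u₂ ≤ u₂ - u₁ := by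
  unfold overlap
  grind

lemma overlap_add {a b u₁ m u₂ : ℝ} (hab : a ≤ b) (h₁ : u₁ ≤ m) (h₂ : m ≤ u₂) :
    overlap a b u₁ u₂ = overlap a b u₁ m + overlap a b m u₂ := by
  unfold overlap
  grind

/-- A constant that depends on the position of `[u₁, u₂]` relative to `(a, b]`. -/
noncomputable def posConst (a b u₁ u₂ : ℝ) : ℝ :=
  if a < u₁ ∧ u₂ ≤ b then 0 else if u₁ ≤ a ∧ b < u₂ then 3 else 2

/-- The bound for the contribution of the cell `(a, b]` to the cost of bisecting `[u₁, u₂]`. -/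
noncomputable def cellPot (a b u₁ u₂ : ℝ) : ℝ :=
  overlap a b u₁ u₂ * (Real.logb 2 ((u₂ - u₁) / overlap a b u₁ u₂) + posConst a b u₁ u₂)

lemma posConst_nonneg (a b u₁ u₂ : ℝ) : 0 ≤ posConst a b u₁ u₂ := by
  unfold posConst
  split_ifs <;> norm_num

lemma posConst_le (a b u₁ u₂ : ℝ) : posConst a b u₁ u₂ ≤ 3 := by
  unfold posConst
  split_ifs <;> norm_num

lemma cellPot_nonneg {a b u₁ u₂ : ℝ} (h : u₁ ≤ u₂) : 0 ≤ cellPot a b u₁ u₂ := by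
  unfold cellPot
  rcases (overlap_nonneg a b u₁ u₂).eq_or_lt with h0 | h0
  · simp [← h0]
  · refine mul_nonneg h0.le (add_nonneg (Real.logb_nonneg one_lt_two ?_) (posConst_nonneg _ _ _ _))
    rw [one_le_div h0]
    exact overlap_le h

lemma logb_half {L l : ℝ} (hL : 0 < L) (hl : 0 < l) :
    Real.logb 2 (L / 2 / l) = Real.logb 2 (L / l) - 1 := by
  rw [div_right_comm, Real.logb_div (by positivity) two_ne_zero]
  simp

/-- The entropy of a two-point law is at most one bit. Each term is bounded by log t ≤ t - 1 at t =
((x + y) / 2) / z, and the linear errors cancel. -/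
lemma entropy_two_le {x y : ℝ} (hx : 0 < x) (hy : 0 < y) :
    x * Real.logb 2 ((x + y) / x) + y * Real.logb 2 ((x + y) / y) ≤ x + y := by
  have aux : ∀ z : ℝ, 0 < z → z * Real.logb 2 ((x + y) / z) ≤
      z + ((x + y) / 2 - z) / Real.log 2 := by
    intro z hz
    have h1 : Real.logb 2 ((x + y) / z) = Real.logb 2 ((x + y) / 2 / z) + 1 := by
      rw [logb_half (by positivity) hz]
      ring
    have h2 : z * Real.log ((x + y) / 2 / z) ≤ (x + y) / 2 - z := by
      have := mul_le_mul_of_nonneg_left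
        (Real.log_le_sub_one_of_pos (show 0 < (x + y) / 2 / z by positivity)) hz.le
      refine this.trans (le_of_eq ?_)
      field_simp
    rw [h1, Real.logb, mul_add, mul_one, add_comm, ← mul_div_assoc]
    gcongr
  have := aux x hx
  have h2 := aux y hy
  have h3 : ((x + y) / 2 - x) / Real.log 2 + ((x + y) / 2 - y) / Real.log 2 = 0 := by
    rw [← add_div]
    ring
  linarith

/-- If only one half meets the cell, log₂(L / l) drops by one, which pays for the overlap. If both
do, this gain can be used up by the entropy of the split x + y, and the drop of the position
constants has to pay. -/
lemma cellPot_step {a b u₁ u₂ : ℝ} (hab : a ≤ b) (hu : u₁ < u₂) (hn : ¬(a < u₁ ∧ u₂ ≤ b)) :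
    overlap a b u₁ u₂ + cellPot a b u₁ ((u₁ + u₂) / 2) + cellPot a b ((u₁ + u₂) / 2) u₂ ≤
      cellPot a b u₁ u₂ := by
  obtain ⟨m, hm⟩ : ∃ m, m = (u₁ + u₂) / 2 := ⟨_, rfl⟩
  rw [← hm]
  have hl := overlap_add (u₁ := u₁) (m := m) (u₂ := u₂) hab (by linarith) (by linarith)
  have d₀ : overlap a b u₁ m = max 0 (min b m - max a u₁) := rfl
  have d₁ : overlap a b m u₂ = max 0 (min b u₂ - max a m) := rfl
  have n₀ := overlap_nonneg a b u₁ m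
  have n₁ := overlap_nonneg a b m u₂
  have e₀ : m - u₁ = (u₂ - u₁) / 2 := by rw [hm]; ring
  have e₁ : u₂ - m = (u₂ - u₁) / 2 := by rw [hm]; ring
  have hL : 0 < u₂ - u₁ := sub_pos.2 hu
  unfold cellPot
  rw [e₀, e₁, hl]
  have k₀ : posConst a b u₁ m = if a < u₁ ∧ m ≤ b then 0 else if u₁ ≤ a ∧ b < m then 3 else 2 := rfl
  have k₁ : posConst a b m u₂ = if a < m ∧ u₂ ≤ b then 0 else if m ≤ a ∧ b < u₂ then 3 else 2 := rfl
  have k : posConst a b u₁ u₂ = if u₁ ≤ a ∧ b < u₂ then 3 else 2 := if_neg hn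
  generalize overlap a b u₁ m = x at *
  generalize overlap a b m u₂ = y at *
  generalize posConst a b u₁ m = κ₀ at *
  generalize posConst a b m u₂ = κ₁ at *
  generalize posConst a b u₁ u₂ = κ at *
  have c₀ : κ₀ ≤ κ := by grind
  have c₁ : κ₁ ≤ κ := by grind
  rcases n₀.eq_or_lt with h0 | h0 <;> rcases n₁.eq_or_lt with h1 | h1
  · simp [← h0, ← h1]
  · rw [← h0, zero_add, zero_mul, logb_half hL h1]
    nlinarith
  · rw [← h1, add_zero, zero_mul, logb_half hL h0]
    nlinarith
  · rw [logb_half hL h1, logb_half hL h0]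
    have hent := entropy_two_le h0 h1
    have hd : ∀ z : ℝ, 0 < z → Real.logb 2 ((u₂ - u₁) / z) =
        Real.logb 2 ((u₂ - u₁) / (x + y)) + Real.logb 2 ((x + y) / z) := by
      intro z hz
      rw [← Real.logb_mul (by positivity) (by positivity)]
      congr 1
      field_simp
    rw [hd x h0, hd y h1]
    -- With one cell end inside the interval, the half within the cell has constant 0 and is the
    -- larger overlap, so 2 suffices. With both ends inside, the constant drops from 3 to 2 on each
    -- side.
    have hκ : x + y + κ₀ * x + κ₁ * y ≤ κ * (x + y) := by
      have ham : a < m := by grind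
      have hmb : m < b := by grind
      have k₀' : κ₀ = if a < u₁ then 0 else 2 := by grind
      have k₁' : κ₁ = if u₂ ≤ b then 0 else 2 := by grind
      by_cases ha : a < u₁ <;> by_cases hb : u₂ ≤ b
      · exact absurd ⟨ha, hb⟩ hn
      · have : κ = 2 := by grind
        have : x = m - u₁ := by grind
        have : y ≤ u₂ - m := by grind
        simp only [ha, hb, if_true, if_false] at k₀' k₁'
        subst k₀' k₁'
        nlinarith
      · have : κ = 2 := by grind
        have : x ≤ m - u₁ := by grind
        have : y = u₂ - m := by grind
        simp only [ha, hb, if_true, if_false] at k₀' k₁'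
        subst k₀' k₁'
        nlinarith
      · have : κ = 3 := by grind
        simp only [ha, hb, if_false] at k₀' k₁'
        subst k₀' k₁'
        nlinarith
    generalize Real.logb 2 ((u₂ - u₁) / (x + y)) = A at *
    generalize Real.logb 2 ((x + y) / x) = X at *
    generalize Real.logb 2 ((x + y) / y) = Y at *
    nlinarith

/-! ### Gibbs' inequality -/

/-- Gibbs' inequality for a single cell. -/
lemma mul_logb_le {p q : ℝ} (r : ℝ) (hp : 0 ≤ p) (hq : 0 < q) (hr : 0 < r) :
    p * Real.logb 2 (r / p) ≤ p * Real.logb 2 (1 / q) + (q * r - p) / Real.log 2 := by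
  have hlog := Real.log_pos one_lt_two
  rcases hp.eq_or_lt with h0 | h0
  · rw [← h0]
    simp only [zero_mul, sub_zero, zero_add]
    positivity
  · have h1 : Real.logb 2 (r / p) = Real.logb 2 (1 / q) + Real.log (q * r / p) / Real.log 2 := by
      rw [← Real.logb, ← Real.logb_mul (by positivity) (by positivity)]
      congr 1
      field_simp
    rw [h1, mul_add, ← mul_div_assoc]
    gcongr
    refine (mul_le_mul_of_nonneg_left
      (Real.log_le_sub_one_of_pos (show 0 < q * r / p by positivity)) h0.le).trans (le_of_eq ?_)
    field_simp

/-- The terms in 1 / log 2 are kept because they cancel after summation over the cells, where the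
overlaps add up to the length and the F to 1. -/
lemma cellPot_le {a b u₁ u₂ F : ℝ} (hu : u₁ < u₂) (hF : 0 < F) :
    cellPot a b u₁ u₂ ≤ overlap a b u₁ u₂ * (3 - 1 / Real.log 2 + Real.logb 2 (1 / F)) +
      F * ((u₂ - u₁) / Real.log 2) := by
  have h := mul_logb_le (u₂ - u₁) (overlap_nonneg a b u₁ u₂) hF (sub_pos.2 hu)
  have h2 := mul_le_mul_of_nonneg_left (posConst_le a b u₁ u₂) (overlap_nonneg a b u₁ u₂)
  have h3 : (F * (u₂ - u₁) - overlap a b u₁ u₂) / Real.log 2 =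
    F * ((u₂ - u₁) / Real.log 2) - overlap a b u₁ u₂ * (1 / Real.log 2) := by ring
  unfold cellPot
  linarith

lemma volume_Ioc_inter (a b u₁ u₂ : ℝ) :
    volume (Ioc a b ∩ Ioc u₁ u₂) = ENNReal.ofReal (overlap a b u₁ u₂) := by
  rw [Ioc_inter_Ioc, Real.volume_Ioc, overlap, ENNReal.ofReal_max]
  simp

/-! ### The law of a density and its quantile function -/

/-- The probability measure with density `f`. -/
noncomputable def law (f : ℝ → ℝ) : Measure ℝ := volume.withDensity fun x => ENNReal.ofReal (f x)

namespace IsDensity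
variable {f : ℝ → ℝ} (hf : IsDensity f)
include hf

lemma setLIntegral (s : Set ℝ) :
    ∫⁻ x in s, ENNReal.ofReal (f x) = ENNReal.ofReal (∫ x in s, f x) :=
  (ofReal_integral_eq_lintegral_ofReal hf.integrable.integrableOn
    (ae_of_all _ hf.nonneg)).symm

lemma aemeasurable_ofReal : AEMeasurable (fun x => ENNReal.ofReal (f x)) :=
  hf.integrable.aestronglyMeasurable.aemeasurable.ennreal_ofReal

lemma lintegral : ∫⁻ x, ENNReal.ofReal (f x) = 1 := by
  rw [← setLIntegral_univ, hf.setLIntegral, setIntegral_univ, hf.integral_eq_one,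
    ENNReal.ofReal_one]

lemma law_apply {s : Set ℝ} (hs : MeasurableSet s) :
    law f s = ENNReal.ofReal (∫ x in s, f x) := by
  rw [law, withDensity_apply _ hs, hf.setLIntegral]

lemma isProbabilityMeasure_law : IsProbabilityMeasure (law f) :=
  ⟨by rw [hf.law_apply MeasurableSet.univ, setIntegral_univ, hf.integral_eq_one,
    ENNReal.ofReal_one]⟩

lemma cdf_eq (x : ℝ) : cdf f x = ProbabilityTheory.cdf (law f) x := by
  have := hf.isProbabilityMeasure_law
  rw [ProbabilityTheory.cdf_eq_real, measureReal_def, hf.law_apply measurableSet_Iic,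
    ENNReal.toReal_ofReal (setIntegral_nonneg measurableSet_Iic fun x _ => hf.nonneg x), cdf]

lemma monotone_cdf : Monotone (cdf f) := fun x y h => by
  rw [hf.cdf_eq, hf.cdf_eq]
  exact ProbabilityTheory.monotone_cdf _ h

lemma cdf_nonneg (x : ℝ) : 0 ≤ cdf f x :=
  setIntegral_nonneg measurableSet_Iic fun x _ => hf.nonneg x

lemma cdf_le_one (x : ℝ) : cdf f x ≤ 1 := by
  rw [hf.cdf_eq]
  exact ProbabilityTheory.cdf_le_one _ x

lemma cdf_sub {x y : ℝ} (h : x ≤ y) : cdf f y - cdf f x = ∫ t in Ioc x y, f t := by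
  unfold cdf
  rw [sub_eq_iff_eq_add', ← setIntegral_union (Iic_disjoint_Ioc le_rfl) measurableSet_Ioc
    hf.integrable.integrableOn hf.integrable.integrableOn, Iic_union_Ioc_eq_Iic h]

/-- The inverse distribution function is attained and real inside the unit interval. -/
lemma exists_cdfInv_eq {u : ℝ} (hu : u ∈ Ioo (0 : ℝ) 1) :
    ∃ q : ℝ, cdfInv f u = q ∧ ∀ x, q ≤ x ↔ u ≤ cdf f x := by
  have hne : ∃ x, u ≤ cdf f x := by
    have := (ProbabilityTheory.tendsto_cdf_atTop (law f)).eventually (lt_mem_nhds hu.2)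
    obtain ⟨x, hx⟩ := this.exists
    exact ⟨x, by rw [hf.cdf_eq]; exact hx.le⟩
  obtain ⟨y, hy⟩ : ∃ y, cdf f y < u := by
    have := (ProbabilityTheory.tendsto_cdf_atBot (law f)).eventually (gt_mem_nhds hu.1)
    obtain ⟨x, hx⟩ := this.exists
    exact ⟨x, by rw [hf.cdf_eq]; exact hx⟩
  have hbdd : BddBelow {x | u ≤ cdf f x} := by
    refine ⟨y, fun x hx => ?_⟩
    by_contra! h
    exact absurd (hf.monotone_cdf h.le) (not_le.2 (hy.trans_le hx))
  -- The infimum is attained because the distribution function is right-continuous.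
  have hmem : u ≤ cdf f (sInf {x | u ≤ cdf f x}) := by
    set q := sInf {x | u ≤ cdf f x} with hq
    have hr : Tendsto (cdf f) (𝓝[>] q) (𝓝 (cdf f q)) := by
      have := ((ProbabilityTheory.cdf (law f)).right_continuous q).tendsto.mono_left
        (nhdsWithin_mono q Ioi_subset_Ici_self)
      rw [hf.cdf_eq]
      refine this.congr fun x => (hf.cdf_eq x).symm
    refine ge_of_tendsto hr ?_
    filter_upwards [self_mem_nhdsWithin] with x hx
    obtain ⟨z, hz, hzx⟩ := exists_lt_of_csInf_lt hne hx
    exact le_trans hz (hf.monotone_cdf hzx.le)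
  refine ⟨sInf {x | u ≤ cdf f x}, ?_, fun x => ⟨fun h => hmem.trans (hf.monotone_cdf h),
    fun h => csInf_le hbdd h⟩⟩
  rw [cdfInv, if_neg hu.1.ne']
  refine IsGLB.sInf_eq (IsLeast.isGLB ⟨⟨_, hmem, rfl⟩, ?_⟩)
  rintro _ ⟨x, hx, rfl⟩
  exact EReal.coe_le_coe_iff.2 (csInf_le hbdd hx)

lemma toReal_cdfInv_le_iff {u : ℝ} (hu : u ∈ Ioo (0 : ℝ) 1) (x : ℝ) :
    (cdfInv f u).toReal ≤ x ↔ u ≤ cdf f x := by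
  obtain ⟨q, hq, h⟩ := hf.exists_cdfInv_eq hu
  rw [hq, EReal.toReal_coe, h]

lemma aemeasurable_toReal_cdfInv :
    AEMeasurable (fun u => (cdfInv f u).toReal) (volume.restrict (Ioo 0 1)) := by
  refine aemeasurable_restrict_of_monotoneOn measurableSet_Ioo fun u hu v hv huv => ?_
  rw [hf.toReal_cdfInv_le_iff hu]
  exact huv.trans ((hf.toReal_cdfInv_le_iff hv _).1 le_rfl)

/-- The inverse distribution function transports the uniform distribution to the law. -/
lemma map_cdfInv : (volume.restrict (Ioo (0 : ℝ) 1)).map (fun u => (cdfInv f u).toReal) = law f := by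
  have := hf.isProbabilityMeasure_law
  have : IsFiniteMeasure (volume.restrict (Ioo (0 : ℝ) 1)) := by
    exact ⟨by simp⟩
  refine Measure.ext_of_Iic _ _ fun x => ?_
  rw [Measure.map_apply_of_aemeasurable hf.aemeasurable_toReal_cdfInv measurableSet_Iic,
    hf.law_apply measurableSet_Iic, Measure.restrict_apply' measurableSet_Ioo]
  have : (fun u => (cdfInv f u).toReal) ⁻¹' Iic x ∩ Ioo 0 1 = Iic (cdf f x) ∩ Ioo 0 1 := by
    ext u
    simp only [mem_inter_iff, mem_preimage, mem_Iic, and_congr_left_iff]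
    exact fun hu => hf.toReal_cdfInv_le_iff hu x
  rw [this, measure_congr ((ae_eq_refl _).inter Ioo_ae_eq_Ioc), inter_comm, Ioc_inter_Iic,
    min_eq_right (hf.cdf_le_one x), Real.volume_Ioc, sub_zero, cdf]

end IsDensity

/-! ### The transformed density -/

lemma transformed_nonneg {f g : ℝ → ℝ} (hf : IsDensity f) (hg : IsDensity g) (u : ℝ) :
    0 ≤ transformed f g u :=
  div_nonneg (hf.nonneg _) (hg.nonneg _)

lemma bddAbove_div {f g : ℝ → ℝ} (hg : IsDensity g)
    (hC : ∃ C : ℝ, ∀ x, f x ≤ C * g x) : BddAbove (range fun x => f x / g x) := by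
  obtain ⟨C, hC⟩ := hC
  refine ⟨max C 0, ?_⟩
  rintro _ ⟨x, rfl⟩
  rcases (hg.nonneg x).eq_or_lt with h | h
  · simp [← h]
  · exact (div_le_iff₀ h).2 ((hC x).trans (mul_le_mul_of_nonneg_right (le_max_left _ _) h.le))

lemma transformed_le {f g : ℝ → ℝ} (hg : IsDensity g)
    (hC : ∃ C : ℝ, ∀ x, f x ≤ C * g x) (u : ℝ) : transformed f g u ≤ rejConst f g :=
  le_ciSup (bddAbove_div hg hC) _

lemma aemeasurable_transformed {f g : ℝ → ℝ} (hf : IsDensity f) (hg : IsDensity g) :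
    AEMeasurable (transformed f g) (volume.restrict (Ioo 0 1)) := by
  have h : AEMeasurable (fun x => f x / g x) (law g) :=
    (hf.integrable.aestronglyMeasurable.aemeasurable.div
      hg.integrable.aestronglyMeasurable.aemeasurable).mono_ac
        (withDensity_absolutelyContinuous _ _)
  rw [← hg.map_cdfInv] at h
  exact h.comp_aemeasurable hg.aemeasurable_toReal_cdfInv

/-- The change of variables x = G⁻¹(u) turns f / g into (f / g) g = f. Where g vanishes, so does f,
by the domination hypothesis. -/
lemma setLIntegral_transformed {f g : ℝ → ℝ} (hf : IsDensity f) (hg : IsDensity g)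
    (hC : ∃ C : ℝ, ∀ x, f x ≤ C * g x) {s : Set ℝ} (hs : MeasurableSet s) :
    ∫⁻ u in Ioo 0 1, ((fun u => (cdfInv g u).toReal) ⁻¹' s).indicator
      (fun u => ENNReal.ofReal (transformed f g u)) u = ∫⁻ x in s, ENNReal.ofReal (f x) := by
  have h : AEMeasurable (fun x => f x / g x) volume :=
    (hf.integrable.aestronglyMeasurable.aemeasurable.div
      hg.integrable.aestronglyMeasurable.aemeasurable)
  have h2 : AEMeasurable (s.indicator fun x => ENNReal.ofReal (f x / g x)) volume :=
    h.ennreal_ofReal.indicator hs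
  have h3 : AEMeasurable (s.indicator fun x => ENNReal.ofReal (f x / g x)) (law g) :=
    h2.mono_ac (withDensity_absolutelyContinuous _ _)
  have h4 := h3
  rw [← hg.map_cdfInv] at h4
  have h5 := lintegral_map' h4 hg.aemeasurable_toReal_cdfInv
  rw [hg.map_cdfInv, law, lintegral_withDensity_eq_lintegral_mul₀ hg.aemeasurable_ofReal h2] at h5
  rw [← lintegral_indicator hs]
  refine Eq.trans h5.symm (lintegral_congr fun x => ?_)
  simp only [Pi.mul_apply, indicator]
  split_ifs with hx
  · rw [← ENNReal.ofReal_mul (hg.nonneg x)]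
    congr 1
    rcases (hg.nonneg x).eq_or_lt with h0 | h0
    · obtain ⟨C, hC⟩ := hC
      have := hC x
      rw [← h0, mul_zero] at this
      rw [← h0, zero_mul]
      exact le_antisymm (hf.nonneg x) this
    · field_simp
  · simp

/-! ### The halting test and the grid -/

lemma cdfInv_le {g : ℝ → ℝ} {u x : ℝ} (hu : 0 < u) (h : u ≤ cdf g x) : cdfInv g u ≤ x := by
  rw [cdfInv, if_neg hu.ne']
  exact sInf_le ⟨x, h, rfl⟩

lemma le_cdfInv {g : ℝ → ℝ} (hg : IsDensity g) {u x : ℝ} (hu : 0 < u) (h : cdf g x < u) :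
    (x : EReal) ≤ cdfInv g u := by
  rw [cdfInv, if_neg hu.ne']
  refine le_sInf ?_
  rintro _ ⟨y, hy, rfl⟩
  refine EReal.coe_le_coe_iff.2 ?_
  by_contra! hyx
  exact absurd (hg.monotone_cdf hyx.le) (not_le.2 (h.trans_le hy))

/-- An interval inside the image of a grid cell passes the halting test. -/
lemma short_of_cell {g : ℝ → ℝ} (hg : IsDensity g) {ε x y u₁ u₂ : ℝ} (hxy : y - x = 2 * ε)
    (hu : u₁ ≤ u₂) (h₁ : cdf g x < u₁) (h₂ : u₂ ≤ cdf g y) : Short g ε u₁ u₂ := by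
  have h0 := (hg.cdf_nonneg x).trans_lt h₁
  refine (EReal.sub_le_sub (cdfInv_le (h0.trans_le hu) h₂) (le_cdfInv hg h0 h₁)).trans ?_
  rw [← EReal.coe_sub, hxy]

section Grid
variable {f : ℝ → ℝ} {ε : ℝ}

lemma cellProb_eq (hf : IsDensity f) (hε : 0 < ε) (j : ℤ) :
    cellProb f ε j = ∫ t in Ioc (2 * ε * j) (2 * ε * (j + 1)), f t :=
  hf.cdf_sub (by nlinarith)

lemma cellProb_nonneg (hf : IsDensity f) (hε : 0 < ε) (j : ℤ) : 0 ≤ cellProb f ε j := by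
  rw [cellProb_eq hf hε]
  exact setIntegral_nonneg measurableSet_Ioc fun x _ => hf.nonneg x

lemma cellProb_le_one (hf : IsDensity f) (j : ℤ) : cellProb f ε j ≤ 1 := by
  have := hf.cdf_le_one (2 * ε * (j + 1))
  have := hf.cdf_nonneg (2 * ε * j)
  unfold cellProb
  linarith

lemma iUnion_cell (hε : 0 < ε) : ⋃ j : ℤ, Ioc (2 * ε * j) (2 * ε * (j + 1)) = univ := by
  have := iUnion_Ioc_zsmul (show (0 : ℝ) < 2 * ε by positivity)
  simpa [zsmul_eq_mul, mul_comm] using this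

lemma pairwise_disjoint_cell (ε : ℝ) :
    Pairwise (Function.onFun Disjoint fun j : ℤ => Ioc (2 * ε * j) (2 * ε * (j + 1))) := by
  have := pairwise_disjoint_Ioc_zsmul (2 * ε)
  simpa [zsmul_eq_mul, mul_comm] using this

lemma tsum_cellProb (hf : IsDensity f) (hε : 0 < ε) :
    ∑' j : ℤ, ENNReal.ofReal (cellProb f ε j) = 1 := by
  simp_rw [cellProb_eq hf hε, ← hf.setLIntegral]
  rw [← lintegral_iUnion (fun _ => measurableSet_Ioc) (pairwise_disjoint_cell ε),
    iUnion_cell hε, setLIntegral_univ, hf.lintegral]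

end Grid

/-! ### The potential of the whole algorithm -/

/-- The weight `3 + log₂ (1 / F(I_j))` of a cell. -/
noncomputable def cellWeight (f : ℝ → ℝ) (ε : ℝ) (j : ℤ) : ℝ≥0∞ :=
  if cellProb f ε j = 0 then ⊤ else ENNReal.ofReal (3 + Real.logb 2 (1 / cellProb f ε j))

/-- The image of a cell of the grid under the distribution function of `g`. -/
def cellImage (g : ℝ → ℝ) (ε : ℝ) (j : ℤ) : Set ℝ :=
  Ioc (cdf g (2 * ε * j)) (cdf g (2 * ε * (j + 1)))

/-- The weight of the cell that contains the quantile of order `u`. -/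
noncomputable def pathWeight (f g : ℝ → ℝ) (ε u : ℝ) : ℝ≥0∞ :=
  ∑' j : ℤ, (cellImage g ε j).indicator (fun _ => cellWeight f ε j) u

open Classical in
/-- The integral over a rectangle of the path weight below the graph of the transformed density
and of the constant `E` above it. -/
noncomputable def rectMass (f g : ℝ → ℝ) (ε : ℝ) (E : ℝ≥0∞) (R : Rect) : ℝ≥0∞ :=
  ∫⁻ u in Ioc R.u₁ R.u₂ ∩ Ioo 0 1, ∫⁻ v in Ico R.v₁ R.v₂,
    if v < transformed f g u then pathWeight f g ε u else E

/-- The total potential of the cells for the bisection of `[u₁, u₂]`. -/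
noncomputable def intervalPot (g : ℝ → ℝ) (ε u₁ u₂ : ℝ) : ℝ≥0∞ :=
  ∑' j : ℤ, ENNReal.ofReal (cellPot (cdf g (2 * ε * j)) (cdf g (2 * ε * (j + 1))) u₁ u₂)

/-- A superharmonic majorant of the cost of the bisection phase. -/
noncomputable def potential (f g : ℝ → ℝ) (ε : ℝ) (E : ℝ≥0∞) : State → ℝ≥0∞
  | .decision R => rectMass f g ε E R / ENNReal.ofReal ((R.u₂ - R.u₁) * (R.v₂ - R.v₁))
  | .bisection u₁ u₂ => intervalPot g ε u₁ u₂ / ENNReal.ofReal (u₂ - u₁)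
  | .halted _ => 0

/-- The states with nondegenerate rectangles over the unit interval. -/
def State.Valid : State → Prop
  | .decision R => 0 ≤ R.u₁ ∧ R.u₁ < R.u₂ ∧ R.u₂ ≤ 1 ∧ R.v₁ < R.v₂
  | .bisection u₁ u₂ => 0 ≤ u₁ ∧ u₁ < u₂ ∧ u₂ ≤ 1
  | .halted _ => True

section
variable {f g : ℝ → ℝ} {ε : ℝ} {E : ℝ≥0∞}

lemma mem_cellImage_iff (hg : IsDensity g) {u : ℝ} (hu : u ∈ Ioo (0 : ℝ) 1) (j : ℤ) :
    u ∈ cellImage g ε j ↔ (cdfInv g u).toReal ∈ Ioc (2 * ε * j) (2 * ε * (j + 1)) := by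
  rw [cellImage, mem_Ioc, mem_Ioc, hg.toReal_cdfInv_le_iff hu, ← not_le,
    ← hg.toReal_cdfInv_le_iff hu, not_le]

lemma cdf_cell_le (hg : IsDensity g) (hε : 0 < ε) (j : ℤ) :
    cdf g (2 * ε * j) ≤ cdf g (2 * ε * (j + 1)) :=
  hg.monotone_cdf (by nlinarith)

lemma measurableSet_cellImage (g : ℝ → ℝ) (ε : ℝ) (j : ℤ) : MeasurableSet (cellImage g ε j) :=
  measurableSet_Ioc

/-- The cells cover the open unit interval, since the quantile of each u lies in some cell of the
grid. -/
lemma ofReal_length_le_tsum (hg : IsDensity g) (hε : 0 < ε) {u₁ u₂ : ℝ} (h₁ : 0 ≤ u₁)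
    (h₂ : u₂ ≤ 1) : ENNReal.ofReal (u₂ - u₁) ≤
      ∑' j : ℤ, ENNReal.ofReal (overlap (cdf g (2 * ε * j)) (cdf g (2 * ε * (j + 1))) u₁ u₂) := by
  rw [← Real.volume_Ioo]
  simp_rw [← volume_Ioc_inter]
  refine le_trans (measure_mono ?_) (measure_iUnion_le _)
  intro u hu
  have hu' : u ∈ Ioo (0 : ℝ) 1 := ⟨h₁.trans_lt hu.1, hu.2.trans_le h₂⟩
  have : (cdfInv g u).toReal ∈ ⋃ j : ℤ, Ioc (2 * ε * j) (2 * ε * (j + 1)) := by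
    rw [iUnion_cell hε]
    trivial
  obtain ⟨j, hj⟩ := mem_iUnion.1 this
  exact mem_iUnion.2 ⟨j, (mem_cellImage_iff hg hu' j).2 hj, hu.1, hu.2.le⟩

/-- A failed halting test excludes containment in any cell, so `cellPot_step` applies to every cell,
and the overlaps sum to at least the length. -/
lemma intervalPot_step (hg : IsDensity g) (hε : 0 < ε) {u₁ u₂ : ℝ} (h₁ : 0 ≤ u₁)
    (h : u₁ < u₂) (h₂ : u₂ ≤ 1) (hs : ¬Short g ε u₁ u₂) :
    ENNReal.ofReal (u₂ - u₁) + intervalPot g ε u₁ ((u₁ + u₂) / 2) +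
      intervalPot g ε ((u₁ + u₂) / 2) u₂ ≤ intervalPot g ε u₁ u₂ := by
  unfold intervalPot
  refine (add_le_add_left (add_le_add_left (ofReal_length_le_tsum hg hε h₁ h₂) _) _).trans ?_
  rw [← ENNReal.tsum_add, ← ENNReal.tsum_add]
  refine ENNReal.tsum_le_tsum fun j => ?_
  rw [← ENNReal.ofReal_add (overlap_nonneg _ _ _ _) (cellPot_nonneg (by linarith)),
    ← ENNReal.ofReal_add (add_nonneg (overlap_nonneg _ _ _ _) (cellPot_nonneg (by linarith)))
      (cellPot_nonneg (by linarith))]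
  refine ENNReal.ofReal_le_ofReal (cellPot_step (cdf_cell_le hg hε j) h fun hj => hs ?_)
  exact short_of_cell hg (by ring) h.le hj.1 hj.2

lemma logb_one_div_cellProb_nonneg (hf : IsDensity f) (hε : 0 < ε) (j : ℤ) :
    0 ≤ Real.logb 2 (1 / cellProb f ε j) := by
  rw [one_div, Real.logb_inv, neg_nonneg]
  exact Real.logb_nonpos one_lt_two (cellProb_nonneg hf hε j) (cellProb_le_one hf j)

/-- This is `cellPot_le` with the negative term moved to the left, as subtraction is truncated in
`ℝ≥0∞`. A cell with F = 0 has infinite weight, so the bound is trivial there. -/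
lemma cellPot_le_weight (hf : IsDensity f) (hε : 0 < ε) {a b u₁ u₂ : ℝ} (hu : u₁ < u₂) (j : ℤ) :
    ENNReal.ofReal (cellPot a b u₁ u₂) +
        ENNReal.ofReal (overlap a b u₁ u₂) * ENNReal.ofReal (1 / Real.log 2) ≤
      ENNReal.ofReal (overlap a b u₁ u₂) * cellWeight f ε j +
        ENNReal.ofReal (cellProb f ε j) * ENNReal.ofReal ((u₂ - u₁) / Real.log 2) := by
  have hl := overlap_nonneg a b u₁ u₂
  have hlog := Real.log_pos one_lt_two
  unfold cellWeight
  split_ifs with h0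
  · rcases hl.eq_or_lt with h | h
    · simp [← h, cellPot]
    · rw [ENNReal.mul_top (ENNReal.ofReal_pos.2 h).ne', top_add]
      exact le_top
  · have hF := cellProb_nonneg hf hε j
    have h1 := logb_one_div_cellProb_nonneg hf hε j
    rw [← ENNReal.ofReal_mul hl, ← ENNReal.ofReal_mul hl, ← ENNReal.ofReal_mul hF,
      ← ENNReal.ofReal_add (cellPot_nonneg hu.le) (by positivity),
      ← ENNReal.ofReal_add (by positivity) (mul_nonneg hF (div_nonneg (by linarith) hlog.le))]
    refine ENNReal.ofReal_le_ofReal ?_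
    have := cellPot_le (a := a) (b := b) hu (hF.lt_of_ne' h0)
    linarith

lemma lintegral_pathWeight (s : Set ℝ) :
    ∫⁻ u in s, pathWeight f g ε u = ∑' j : ℤ, cellWeight f ε j * volume (cellImage g ε j ∩ s) := by
  unfold pathWeight
  rw [lintegral_tsum fun j =>
    (measurable_const.indicator (measurableSet_cellImage g ε j)).aemeasurable]
  congr 1
  ext j
  rw [lintegral_indicator_const (measurableSet_cellImage g ε j),
    Measure.restrict_apply (measurableSet_cellImage g ε j)]

lemma intervalPot_le (hf : IsDensity f) (hg : IsDensity g) (hε : 0 < ε) {u₁ u₂ : ℝ} (h₁ : 0 ≤ u₁)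
    (h : u₁ < u₂) (h₂ : u₂ ≤ 1) :
    intervalPot g ε u₁ u₂ ≤ ∫⁻ u in Ioc u₁ u₂, pathWeight f g ε u := by
  have hlog := Real.log_pos one_lt_two
  rw [lintegral_pathWeight]
  have hL : (∑' j : ℤ, ENNReal.ofReal (cellProb f ε j) *
      ENNReal.ofReal ((u₂ - u₁) / Real.log 2)) = ENNReal.ofReal ((u₂ - u₁) / Real.log 2) := by
    rw [ENNReal.tsum_mul_right, tsum_cellProb hf hε, one_mul]
  have hU : ENNReal.ofReal ((u₂ - u₁) / Real.log 2) ≤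
      ∑' j : ℤ, ENNReal.ofReal (overlap (cdf g (2 * ε * j)) (cdf g (2 * ε * (j + 1))) u₁ u₂) *
        ENNReal.ofReal (1 / Real.log 2) := by
    rw [ENNReal.tsum_mul_right, div_eq_mul_one_div, ENNReal.ofReal_mul (by linarith)]
    gcongr
    exact ofReal_length_le_tsum hg hε h₁ h₂
  have key := ENNReal.tsum_le_tsum fun j : ℤ => cellPot_le_weight hf hε
    (a := cdf g (2 * ε * j)) (b := cdf g (2 * ε * (j + 1))) h j
  rw [ENNReal.tsum_add, ENNReal.tsum_add, hL] at key
  have := (add_le_add_right hU (intervalPot g ε u₁ u₂)).trans key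
  -- The term L / log 2 appears on both sides: on the right since the F(I_j) sum to 1, on the left
  -- since the overlaps sum to at least L. It is finite and cancels.
  rw [ENNReal.add_le_add_iff_right ENNReal.ofReal_ne_top] at this
  refine this.trans (ENNReal.tsum_le_tsum fun j => ?_)
  rw [cellImage, volume_Ioc_inter, mul_comm]

lemma setLIntegral_Ioc_inter {u₁ u₂ : ℝ} (h₁ : 0 ≤ u₁) (h₂ : u₂ ≤ 1) (F : ℝ → ℝ≥0∞) :
    ∫⁻ u in Ioc u₁ u₂ ∩ Ioo 0 1, F u = ∫⁻ u in Ioc u₁ u₂, F u := by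
  refine setLIntegral_congr ?_
  have : (Ioc u₁ u₂ ∩ Ioo 0 1 : Set ℝ) =ᵐ[volume] (Ioc u₁ u₂ ∩ Ioc 0 1 : Set ℝ) :=
    (ae_eq_refl _).inter Ioo_ae_eq_Ioc
  refine this.trans ?_
  rw [inter_eq_left.2 (Ioc_subset_Ioc h₁ h₂)]
  exact ae_eq_refl _

lemma rectMass_of_accepting {R : Rect} (hR : (State.decision R).Valid)
    (hacc : R.Accepting (transformed f g)) :
    rectMass f g ε E R =
      (∫⁻ u in Ioc R.u₁ R.u₂, pathWeight f g ε u) * ENNReal.ofReal (R.v₂ - R.v₁) := by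
  rw [← setLIntegral_Ioc_inter hR.1 hR.2.2.1, ← lintegral_mul_const' _ _ ENNReal.ofReal_ne_top]
  refine setLIntegral_congr_fun (measurableSet_Ioc.inter measurableSet_Ioo) fun u hu => ?_
  rw [setLIntegral_congr_fun measurableSet_Ico (g := fun _ => pathWeight f g ε u)]
  · rw [setLIntegral_const, Real.volume_Ico]
  · intro v hv
    -- The half-open v-interval gives v < v₂, hence the strict inequality required below the graph.
    exact if_pos (hv.2.trans_le
      (hacc u ⟨Ioc_subset_Icc_self hu.1, hu.2⟩ R.v₂ ⟨hR.2.2.2.le, le_rfl⟩))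

lemma rectMass_of_rejecting {R : Rect} (hR : (State.decision R).Valid)
    (hrej : R.Rejecting (transformed f g)) :
    rectMass f g ε E R = E * ENNReal.ofReal ((R.u₂ - R.u₁) * (R.v₂ - R.v₁)) := by
  have hu : 0 ≤ R.u₂ - R.u₁ := sub_nonneg.2 hR.2.1.le
  have : rectMass f g ε E R =
      ∫⁻ u in Ioc R.u₁ R.u₂ ∩ Ioo 0 1, E * ENNReal.ofReal (R.v₂ - R.v₁) := by
    refine setLIntegral_congr_fun (measurableSet_Ioc.inter measurableSet_Ioo) fun u hu => ?_
    rw [setLIntegral_congr_fun measurableSet_Ico (g := fun _ => E)]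
    · rw [setLIntegral_const, Real.volume_Ico]
    · intro v hv
      exact if_neg (hrej u ⟨Ioc_subset_Icc_self hu.1, hu.2⟩ v (Ico_subset_Icc_self hv)).not_gt
  rw [this, setLIntegral_Ioc_inter hR.1 hR.2.2.1, setLIntegral_const, Real.volume_Ioc,
    ENNReal.ofReal_mul hu, mul_assoc, mul_comm (ENNReal.ofReal (R.v₂ - R.v₁))]

/-- Only superadditivity of the lower integral is used; it needs no measurability of the inner
integrals. -/
lemma sum_rectMass_child_le {R : Rect} (hR : (State.decision R).Valid) :
    ∑ b : Bool × Bool, rectMass f g ε E (R.child b) ≤ rectMass f g ε E R := by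
  classical
  obtain ⟨h0, hu, h1, hv⟩ := hR
  have hU : ∀ F : ℝ → ℝ≥0∞, ∫⁻ u in Ioc R.u₁ R.u₂ ∩ Ioo 0 1, F u =
      (∫⁻ u in Ioc R.u₁ ((R.u₁ + R.u₂) / 2) ∩ Ioo 0 1, F u) +
        ∫⁻ u in Ioc ((R.u₁ + R.u₂) / 2) R.u₂ ∩ Ioo 0 1, F u := by
    intro F
    rw [← lintegral_union (measurableSet_Ioc.inter measurableSet_Ioo)
      ((Ioc_disjoint_Ioc_of_le le_rfl).mono inter_subset_left inter_subset_left),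
      ← union_inter_distrib_right, Ioc_union_Ioc_eq_Ioc (by linarith) (by linarith)]
  have hV : ∀ F : ℝ → ℝ≥0∞, ∫⁻ v in Ico R.v₁ R.v₂, F v =
      (∫⁻ v in Ico R.v₁ ((R.v₁ + R.v₂) / 2), F v) +
        ∫⁻ v in Ico ((R.v₁ + R.v₂) / 2) R.v₂, F v := by
    intro F
    rw [← lintegral_union measurableSet_Ico (Ico_disjoint_Ico_same),
      Ico_union_Ico_eq_Ico (by linarith) (by linarith)]
  rw [Fintype.sum_prod_type]
  simp only [Fintype.sum_bool, rectMass, Rect.child, if_true, Bool.false_eq_true, if_false]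
  rw [hU, add_comm]
  simp_rw [hV]
  refine add_le_add ?_ ?_
  · rw [add_comm]
    exact le_lintegral_add _ _
  · rw [add_comm]
    exact le_lintegral_add _ _

lemma tsum_weight_mul (hf : IsDensity f) (hε : 0 < ε) :
    ∑' j : ℤ, cellWeight f ε j * ENNReal.ofReal (cellProb f ε j) = 3 + gridEntropy f ε := by
  have : ∀ j : ℤ, cellWeight f ε j * ENNReal.ofReal (cellProb f ε j) =
      3 * ENNReal.ofReal (cellProb f ε j) +
        ENNReal.ofReal (cellProb f ε j * Real.logb 2 (1 / cellProb f ε j)) := by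
    intro j
    unfold cellWeight
    split_ifs with h
    -- The infinite weight meets mass 0, and ⊤ * 0 = 0.
    · simp [h]
    · rw [ENNReal.ofReal_add (by norm_num) (logb_one_div_cellProb_nonneg hf hε j), add_mul,
        mul_comm (cellProb f ε j), ENNReal.ofReal_mul (logb_one_div_cellProb_nonneg hf hε j)]
      norm_num
  simp_rw [this]
  rw [ENNReal.tsum_add, ENNReal.tsum_mul_left, tsum_cellProb hf hε, mul_one, gridEntropy]

lemma lintegral_transformed_mul_pathWeight (hf : IsDensity f) (hg : IsDensity g)
    (hC : ∃ C : ℝ, ∀ x, f x ≤ C * g x) (hε : 0 < ε) :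
    ∫⁻ u in Ioo 0 1, pathWeight f g ε u * ENNReal.ofReal (transformed f g u) =
      3 + gridEntropy f ε := by
  unfold pathWeight
  simp_rw [← ENNReal.tsum_mul_right]
  have hmeas : ∀ j : ℤ, AEMeasurable (fun u => (cellImage g ε j).indicator
      (fun _ => cellWeight f ε j) u * ENNReal.ofReal (transformed f g u))
      (volume.restrict (Ioo 0 1)) := fun j =>
    AEMeasurable.mul (measurable_const.indicator (measurableSet_cellImage g ε j)).aemeasurable
      (aemeasurable_transformed hf hg).ennreal_ofReal
  rw [lintegral_tsum hmeas, ← tsum_weight_mul hf hε]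
  congr 1
  ext j
  rw [cellProb_eq hf hε, ← hf.setLIntegral,
    ← setLIntegral_transformed hf hg hC measurableSet_Ioc, ← lintegral_const_mul'']
  · refine setLIntegral_congr_fun measurableSet_Ioo fun u hu => ?_
    simp only [indicator, mem_preimage, mem_cellImage_iff hg hu]
    split_ifs <;> simp
  · exact (aemeasurable_transformed hf hg).ennreal_ofReal.indicator₀
      (hg.aemeasurable_toReal_cdfInv.nullMeasurable measurableSet_Ioc)

/-- E is a fixed point: the part below the graph has area 1 and contributes E, the part above has
area C - 1 and contributes E (C - 1). -/
lemma rectMass_root_le (hf : IsDensity f) (hg : IsDensity g)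
    (hC : ∃ C : ℝ, ∀ x, f x ≤ C * g x) (hε : 0 < ε) :
    rectMass f g ε (3 + gridEntropy f ε) (root f g) ≤
      (3 + gridEntropy f ε) * ENNReal.ofReal (rejConst f g) := by
  classical
  have hIoo : Ioc (0 : ℝ) 1 ∩ Ioo 0 1 = Ioo 0 1 := inter_eq_right.2 Ioo_subset_Ioc_self
  have hm := (aemeasurable_transformed hf hg)
  have hφ : ∫⁻ u in Ioo 0 1, ENNReal.ofReal (transformed f g u) = 1 := by
    have := setLIntegral_transformed hf hg hC MeasurableSet.univ
    simpa [hf.lintegral] using this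
  have hsub : AEMeasurable (fun u => ENNReal.ofReal (rejConst f g - transformed f g u))
      (volume.restrict (Ioo 0 1)) := (AEMeasurable.sub aemeasurable_const hm).ennreal_ofReal
  set E := 3 + gridEntropy f ε with hE
  have hin : ∀ u, (∫⁻ v in Ico 0 (rejConst f g),
      if v < transformed f g u then pathWeight f g ε u else E) =
      pathWeight f g ε u * ENNReal.ofReal (transformed f g u) +
        E * ENNReal.ofReal (rejConst f g - transformed f g u) := by
    intro u
    rw [← Ico_union_Ico_eq_Ico (transformed_nonneg hf hg u) (transformed_le hg hC u),
      lintegral_union measurableSet_Ico (Ico_disjoint_Ico_same),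
      setLIntegral_congr_fun (s := Ico 0 _) measurableSet_Ico
        (g := fun _ => pathWeight f g ε u) fun v hv => if_pos hv.2,
      setLIntegral_congr_fun (s := Ico (transformed f g u) _) measurableSet_Ico
        (g := fun _ => E) fun v hv => if_neg hv.1.not_gt]
    simp
  have hsplit : (∫⁻ u in Ioo 0 1, ENNReal.ofReal (rejConst f g - transformed f g u)) + 1 =
      ENNReal.ofReal (rejConst f g) := by
    rw [← hφ, ← lintegral_add_right' _ hm.ennreal_ofReal]
    calc _ = ∫⁻ u in Ioo (0 : ℝ) 1, ENNReal.ofReal (rejConst f g) := by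
          refine lintegral_congr fun u => ?_
          rw [← ENNReal.ofReal_add (sub_nonneg.2 (transformed_le hg hC u))
            (transformed_nonneg hf hg u), sub_add_cancel]
      _ = _ := by simp
  simp only [rectMass, root, hIoo, hin]
  rw [lintegral_add_right' _ (hsub.const_mul E),
    lintegral_transformed_mul_pathWeight hf hg hC hε, ← hE,
    lintegral_const_mul'' _ hsub, ← hsplit, mul_add, mul_one,
    add_comm]

lemma rejConst_pos (hf : IsDensity f) (hg : IsDensity g)
    (hC : ∃ C : ℝ, ∀ x, f x ≤ C * g x) : 0 < rejConst f g := by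
  by_contra! h
  have h0 : ∀ u, transformed f g u = 0 := fun u =>
    le_antisymm ((transformed_le hg hC u).trans h) (transformed_nonneg hf hg u)
  have := setLIntegral_transformed hf hg hC MeasurableSet.univ
  simp [hf.lintegral, h0] at this

lemma valid_step (hf : IsDensity f) (hg : IsDensity g) (hC : ∃ C : ℝ, ∀ x, f x ≤ C * g x)
    (s : State) (hs : s.Valid) (b : Bool × Bool) : (step f g ε b s).Valid := by
  have hroot := rejConst_pos hf hg hC
  match s, hs with
  | .decision R, ⟨h0, hu, h1, hv⟩ =>
    simp only [step]
    split_ifs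
    · exact ⟨h0, hu, h1⟩
    · exact ⟨le_rfl, zero_lt_one, le_rfl, hroot⟩
    · simp only [State.Valid, Rect.child]
      refine ⟨?_, ?_, ?_, ?_⟩ <;> split_ifs <;> linarith
  | .bisection u₁ u₂, ⟨h0, hu, h1⟩ =>
    simp only [step]
    split_ifs
    · trivial
    · exact ⟨by linarith, by linarith, h1⟩
    · exact ⟨h0, by linarith, by linarith⟩
  | .halted x, _ => trivial

lemma meanStep_const {h : State → ℝ≥0∞} {s : State} {c : ℝ≥0∞}
    (hc : ∀ b, h (step f g ε b s) = c) : meanStep f g ε h s = c := by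
  simp only [meanStep, hc, Finset.sum_const, Finset.card_univ, Fintype.card_prod,
    Fintype.card_bool, nsmul_eq_mul, ← mul_assoc]
  rw [show ((2 * 2 : ℕ) : ℝ≥0∞) = 4 by norm_num,
    ENNReal.mul_inv_cancel (by norm_num) (by norm_num), one_mul]

lemma potential_root_le (hf : IsDensity f) (hg : IsDensity g)
    (hC : ∃ C : ℝ, ∀ x, f x ≤ C * g x) (hε : 0 < ε) :
    potential f g ε (3 + gridEntropy f ε) (.decision (root f g)) ≤ 3 + gridEntropy f ε := by
  have hpos := rejConst_pos hf hg hC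
  refine ENNReal.div_le_of_le_mul ?_
  have : ((root f g).u₂ - (root f g).u₁) * ((root f g).v₂ - (root f g).v₁) = rejConst f g := by
    simp [root]
  rw [this]
  exact rectMass_root_le hf hg hC hε

lemma ofReal_half {x : ℝ} (y : ℝ) (h : y = x / 2) (A : ℝ≥0∞) :
    2⁻¹ * (A / ENNReal.ofReal y) = A / ENNReal.ofReal x := by
  rw [show x = 2 * y by rw [h]; ring, ENNReal.ofReal_mul zero_le_two, div_eq_mul_inv,
    div_eq_mul_inv, ENNReal.mul_inv (by simp) (by simp), ENNReal.ofReal_ofNat]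
  ring

lemma potential_bisection (hg : IsDensity g) (hε : 0 < ε) {u₁ u₂ : ℝ}
    (hs : (State.bisection u₁ u₂).Valid) :
    bisectionCost g ε (.bisection u₁ u₂) + meanStep f g ε (potential f g ε E) (.bisection u₁ u₂) ≤
      potential f g ε E (.bisection u₁ u₂) := by
  obtain ⟨h0, hu, h1⟩ := hs
  by_cases hS : Short g ε u₁ u₂
  · rw [meanStep_const (c := 0) fun b => by simp [step, hS, potential]]
    simp [bisectionCost, hS]
  · have hL : ENNReal.ofReal (u₂ - u₁) ≠ 0 := (ENNReal.ofReal_pos.2 (sub_pos.2 hu)).ne'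
    have h4 : (4⁻¹ : ℝ≥0∞) + 4⁻¹ = 2⁻¹ := by
      rw [← two_mul, show (4 : ℝ≥0∞) = 2 * 2 by norm_num,
        ENNReal.mul_inv (by simp) (by simp), ← mul_assoc,
        ENNReal.mul_inv_cancel (by simp) (by simp), one_mul]
    have hmean : meanStep f g ε (potential f g ε E) (.bisection u₁ u₂) =
        intervalPot g ε ((u₁ + u₂) / 2) u₂ / ENNReal.ofReal (u₂ - u₁) +
          intervalPot g ε u₁ ((u₁ + u₂) / 2) / ENNReal.ofReal (u₂ - u₁) := by
      rw [← ofReal_half (x := u₂ - u₁) (u₂ - (u₁ + u₂) / 2) (by ring)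
          (intervalPot g ε ((u₁ + u₂) / 2) u₂),
        ← ofReal_half (x := u₂ - u₁) ((u₁ + u₂) / 2 - u₁) (by ring)]
      simp only [meanStep, Fintype.sum_prod_type, Fintype.sum_bool, step, hS, if_false, if_true,
        Bool.false_eq_true, potential, ← h4]
      ring
    rw [hmean, potential, bisectionCost, if_neg hS,
      ← ENNReal.div_self hL ENNReal.ofReal_ne_top, ← ENNReal.add_div, ← ENNReal.add_div]
    gcongr
    rw [add_comm (intervalPot g ε ((u₁ + u₂) / 2) u₂), ← add_assoc]
    exact intervalPot_step hg hε h0 hu h1 hS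

/-- The hypothesis on E pays for a restart: a rejected rectangle has potential exactly E. -/
lemma potential_decision (hf : IsDensity f) (hg : IsDensity g) (hε : 0 < ε)
    (hE : potential f g ε E (.decision (root f g)) ≤ E) {R : Rect}
    (hR : (State.decision R).Valid) :
    meanStep f g ε (potential f g ε E) (.decision R) ≤ potential f g ε E (.decision R) := by
  have hu := sub_pos.2 hR.2.1
  have hv := sub_pos.2 hR.2.2.2
  by_cases hacc : R.Accepting (transformed f g)
  · rw [meanStep_const (c := potential f g ε E (.bisection R.u₁ R.u₂)) fun b => by
      simp [step, hacc]]
    simp only [potential]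
    rw [rectMass_of_accepting hR hacc, ENNReal.ofReal_mul hu.le,
      ENNReal.mul_div_mul_right _ _ (ENNReal.ofReal_pos.2 hv).ne' ENNReal.ofReal_ne_top]
    gcongr
    exact intervalPot_le hf hg hε hR.1 hR.2.1 hR.2.2.1
  · by_cases hrej : R.Rejecting (transformed f g)
    · rw [meanStep_const (c := potential f g ε E (.decision (root f g))) fun b => by
        simp [step, hacc, hrej]]
      refine hE.trans (le_of_eq ?_)
      rw [potential, rectMass_of_rejecting hR hrej, ENNReal.mul_div_cancel_right
        (ENNReal.ofReal_pos.2 (mul_pos hu hv)).ne' ENNReal.ofReal_ne_top]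
    · have hb : ∀ b : Bool × Bool, 4⁻¹ * potential f g ε E (step f g ε b (.decision R)) =
          rectMass f g ε E (R.child b) / ENNReal.ofReal ((R.u₂ - R.u₁) * (R.v₂ - R.v₁)) := by
        intro b
        have harea : ((R.child b).u₂ - (R.child b).u₁) * ((R.child b).v₂ - (R.child b).v₁) =
            (R.u₂ - R.u₁) * (R.v₂ - R.v₁) / 2 / 2 := by
          simp only [Rect.child]
          split_ifs <;> ring
        have h4 : (4⁻¹ : ℝ≥0∞) = 2⁻¹ * 2⁻¹ := by
          rw [← ENNReal.mul_inv (by simp) (by simp)]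
          norm_num
        simp only [step, hacc, hrej, if_false, potential]
        rw [h4, mul_assoc, ofReal_half _ harea, ofReal_half _ rfl]
      simp only [meanStep, hb]
      simp only [potential]
      simp_rw [div_eq_mul_inv]
      rw [← Finset.sum_mul]
      gcongr
      exact sum_rectMass_child_le hR

/-- The expected number of bits is at most the entropy of the grid plus three. -/
theorem expectedBisectionBits_le_gridEntropy (hf : IsDensity f) (hg : IsDensity g)
    (hC : ∃ C : ℝ, ∀ x, f x ≤ C * g x) (hε : 0 < ε) :
    expectedBisectionBits f g ε ≤ 3 + gridEntropy f ε := by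
  have hroot := potential_root_le hf hg hC hε
  refine (expectedBisectionBits_le f g ε (Φ := potential f g ε (3 + gridEntropy f ε))
    (P := State.Valid) (valid_step hf hg hC) ?_ ?_).trans hroot
  · intro s hs
    match s, hs with
    | .decision R, hR =>
      rw [bisectionCost, zero_add]
      exact potential_decision hf hg hε hroot hR
    | .bisection u₁ u₂, hs => exact potential_bisection hg hε hs
    | .halted x, _ =>
      rw [meanStep_const (c := 0) fun b => by simp [step, potential]]
      simp [bisectionCost]
  · exact ⟨le_rfl, zero_lt_one, le_rfl, rejConst_pos hf hg hC⟩

end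

/-! ### Laplace smoothing and integrability of the entropy integrand -/

/-- The convolution of `f` with the Laplace density. -/
noncomputable def laplaceSmooth (f : ℝ → ℝ) (x : ℝ) : ℝ := 2⁻¹ * ∫ t, f t * Real.exp (-|x - t|)

lemma integral_exp_neg_abs : ∫ x : ℝ, Real.exp (-|x|) = 2 := by
  rw [integral_comp_abs (f := fun x => Real.exp (-x)), integral_exp_neg_Ioi_zero, mul_one]

lemma integrable_exp_neg_abs : Integrable fun x : ℝ => Real.exp (-|x|) :=
  Integrable.of_integral_ne_zero (by rw [integral_exp_neg_abs]; norm_num)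

lemma laplaceSmooth_eq_convolution (f : ℝ → ℝ) : laplaceSmooth f =
    fun x => 2⁻¹ * convolution f (fun x : ℝ => Real.exp (-|x|)) (ContinuousLinearMap.mul ℝ ℝ)
      volume x := by
  ext x
  rfl

section
variable {f : ℝ → ℝ} (hf : IsDensity f)
include hf

lemma integrable_mul_exp_neg_abs (x : ℝ) : Integrable fun t => f t * Real.exp (-|x - t|) := by
  refine hf.integrable.mul_bdd (c := 1) (by fun_prop) (ae_of_all _ fun t => ?_)
  rw [Real.norm_eq_abs, abs_of_pos (Real.exp_pos _), Real.exp_le_one_iff, neg_nonpos]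
  exact abs_nonneg _

lemma integrable_laplaceSmooth : Integrable (laplaceSmooth f) := by
  rw [laplaceSmooth_eq_convolution f]
  exact (hf.integrable.integrable_convolution _ integrable_exp_neg_abs).const_mul _

lemma integral_laplaceSmooth : ∫ x, laplaceSmooth f x = 1 := by
  rw [laplaceSmooth_eq_convolution f, integral_const_mul,
    integral_convolution _ hf.integrable integrable_exp_neg_abs, integral_exp_neg_abs,
    hf.integral_eq_one]
  simp

lemma laplaceSmooth_le_one (x : ℝ) : laplaceSmooth f x ≤ 1 := by
  have : ∫ t, f t * Real.exp (-|x - t|) ≤ ∫ t, f t := by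
    refine integral_mono (integrable_mul_exp_neg_abs hf x) hf.integrable fun t => ?_
    refine mul_le_of_le_one_right (hf.nonneg t) ?_
    rw [Real.exp_le_one_iff, neg_nonpos]
    exact abs_nonneg _
  rw [hf.integral_eq_one] at this
  unfold laplaceSmooth
  linarith

/-- The triangle inequality in the exponent makes the logarithm of the smoothing 1-Lipschitz; this
gives continuity and slow variation. -/
lemma laplaceSmooth_le (x y : ℝ) :
    laplaceSmooth f x ≤ Real.exp |x - y| * laplaceSmooth f y := by
  unfold laplaceSmooth
  rw [mul_left_comm, ← integral_const_mul (Real.exp |x - y|)]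
  refine mul_le_mul_of_nonneg_left ?_ (show (0 : ℝ) ≤ 2⁻¹ by norm_num)
  refine integral_mono (integrable_mul_exp_neg_abs hf x)
    ((integrable_mul_exp_neg_abs hf y).const_mul _) fun t => ?_
  simp only
  rw [mul_left_comm, ← Real.exp_add]
  refine mul_le_mul_of_nonneg_left (Real.exp_le_exp.2 ?_) (hf.nonneg t)
  have := abs_sub_le y x t
  rw [abs_sub_comm y x] at this
  linarith

lemma laplaceSmooth_pos (x : ℝ) : 0 < laplaceSmooth f x := by
  unfold laplaceSmooth
  refine mul_pos (by norm_num) ?_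
  rw [integral_pos_iff_support_of_nonneg
    (fun t => mul_nonneg (hf.nonneg t) (Real.exp_pos _).le) (integrable_mul_exp_neg_abs hf x)]
  have : (Function.support fun t => f t * Real.exp (-|x - t|)) = Function.support f := by
    ext t
    simp [Real.exp_ne_zero]
  rw [this, ← integral_pos_iff_support_of_nonneg hf.nonneg hf.integrable, hf.integral_eq_one]
  exact zero_lt_one

lemma continuous_laplaceSmooth : Continuous (laplaceSmooth f) := by
  rw [continuous_iff_continuousAt]
  intro x
  have h1 : Tendsto (fun y => Real.exp |y - x| * laplaceSmooth f x) (𝓝 x)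
      (𝓝 (laplaceSmooth f x)) := by
    have : Continuous fun y => Real.exp |y - x| * laplaceSmooth f x := by fun_prop
    simpa using this.tendsto x
  have h2 : Tendsto (fun y => Real.exp (-|y - x|) * laplaceSmooth f x) (𝓝 x)
      (𝓝 (laplaceSmooth f x)) := by
    have : Continuous fun y => Real.exp (-|y - x|) * laplaceSmooth f x := by fun_prop
    simpa using this.tendsto x
  refine tendsto_of_tendsto_of_tendsto_of_le_of_le h2 h1 (fun y => ?_) fun y =>
    laplaceSmooth_le hf y x
  simp only
  rw [Real.exp_neg, inv_mul_le_iff₀ (Real.exp_pos _), abs_sub_comm]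
  exact laplaceSmooth_le hf x y

/-- Points of one cell of the grid with ε = 1 are at distance at most 2, whence exp(-2). Thus the
cross entropy relative to the smoothing exceeds the grid entropy by at most a constant. -/
lemma mul_cellProb_le_laplaceSmooth {j : ℤ} {x : ℝ}
    (hx : x ∈ Ioc (2 * 1 * (j : ℝ)) (2 * 1 * (j + 1))) :
    2⁻¹ * Real.exp (-2) * cellProb f 1 j ≤ laplaceSmooth f x := by
  rw [cellProb_eq hf one_pos, mul_assoc, ← integral_const_mul]
  unfold laplaceSmooth
  refine mul_le_mul_of_nonneg_left ?_ (by norm_num)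
  calc ∫ t in Ioc (2 * 1 * (j : ℝ)) (2 * 1 * (j + 1)), Real.exp (-2) * f t
      ≤ ∫ t in Ioc (2 * 1 * (j : ℝ)) (2 * 1 * (j + 1)), f t * Real.exp (-|x - t|) := by
        refine setIntegral_mono_on (hf.integrable.integrableOn.const_mul _)
          (integrable_mul_exp_neg_abs hf x).integrableOn measurableSet_Ioc fun t ht => ?_
        rw [mul_comm]
        refine mul_le_mul_of_nonneg_left (Real.exp_le_exp.2 (neg_le_neg ?_)) (hf.nonneg t)
        rw [abs_le]
        constructor <;> linarith [hx.1, hx.2, ht.1, ht.2]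
    _ ≤ ∫ t, f t * Real.exp (-|x - t|) := setIntegral_le_integral (integrable_mul_exp_neg_abs hf x)
        (ae_of_all _ fun t => mul_nonneg (hf.nonneg t) (Real.exp_pos _).le)

lemma logb_one_div_laplaceSmooth_nonneg (x : ℝ) : 0 ≤ Real.logb 2 (1 / laplaceSmooth f x) :=
  Real.logb_nonneg one_lt_two
    ((one_le_div (laplaceSmooth_pos hf x)).2 (laplaceSmooth_le_one hf x))

lemma continuous_logb_laplaceSmooth : Continuous fun x => Real.logb 2 (1 / laplaceSmooth f x) := by
  have h : ∀ x, 1 / laplaceSmooth f x ≠ 0 := fun x => (one_div_pos.2 (laplaceSmooth_pos hf x)).ne'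
  exact ((continuous_const.div (continuous_laplaceSmooth hf)
    fun x => (laplaceSmooth_pos hf x).ne').log h).div_const _

lemma setLIntegral_mul_logb_laplaceSmooth_le (j : ℤ) :
    ∫⁻ x in Ioc (2 * 1 * (j : ℝ)) (2 * 1 * (j + 1)),
        ENNReal.ofReal (f x * Real.logb 2 (1 / laplaceSmooth f x)) ≤
      ENNReal.ofReal (cellProb f 1 j * Real.logb 2 (1 / cellProb f 1 j)) +
        ENNReal.ofReal (Real.logb 2 (2 * Real.exp 2)) * ENNReal.ofReal (cellProb f 1 j) := by
  have hF := cellProb_nonneg hf one_pos j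
  have hlint : ∫⁻ x in Ioc (2 * 1 * (j : ℝ)) (2 * 1 * (j + 1)), ENNReal.ofReal (f x) =
      ENNReal.ofReal (cellProb f 1 j) := by
    rw [hf.setLIntegral, cellProb_eq hf one_pos]
  rcases hF.eq_or_lt with h0 | h0
  · rw [← h0, ENNReal.ofReal_zero, lintegral_eq_zero_iff' hf.aemeasurable_ofReal.restrict] at hlint
    refine le_of_eq_of_le (lintegral_eq_zero_of_ae_eq_zero ?_) zero_le
    filter_upwards [hlint] with x hx
    rw [ENNReal.ofReal_mul (hf.nonneg x), hx]
    simp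
  · have hc : 0 ≤ Real.logb 2 (2 * Real.exp 2) :=
      Real.logb_nonneg one_lt_two (by nlinarith [Real.add_one_le_exp 2])
    have hl := logb_one_div_cellProb_nonneg hf one_pos j
    calc ∫⁻ x in Ioc (2 * 1 * (j : ℝ)) (2 * 1 * (j + 1)),
          ENNReal.ofReal (f x * Real.logb 2 (1 / laplaceSmooth f x))
        ≤ ∫⁻ x in Ioc (2 * 1 * (j : ℝ)) (2 * 1 * (j + 1)), ENNReal.ofReal (f x) *
          ENNReal.ofReal (Real.logb 2 (1 / cellProb f 1 j) + Real.logb 2 (2 * Real.exp 2)) := by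
          refine setLIntegral_mono' measurableSet_Ioc fun x hx => ?_
          rw [ENNReal.ofReal_mul (hf.nonneg x)]
          gcongr
          rw [← Real.logb_mul (by positivity) (by positivity)]
          refine Real.logb_le_logb_of_le one_lt_two (one_div_pos.2 (laplaceSmooth_pos hf x)) ?_
          have := mul_cellProb_le_laplaceSmooth hf hx
          rw [div_mul_eq_mul_div, one_mul, div_le_div_iff₀ (laplaceSmooth_pos hf x) h0, one_mul]
          refine le_trans (le_of_eq ?_) (mul_le_mul_of_nonneg_left this
            (show 0 ≤ 2 * Real.exp 2 by positivity))
          rw [Real.exp_neg]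
          field_simp
      _ = _ := by
          rw [lintegral_mul_const' _ _ ENNReal.ofReal_ne_top, hlint, ENNReal.ofReal_add hl hc,
            mul_add, ← ENNReal.ofReal_mul hF, mul_comm (ENNReal.ofReal (cellProb f 1 j))]

lemma integrable_mul_logb_laplaceSmooth (hH : gridEntropy f 1 ≠ ⊤) :
    Integrable fun x => f x * Real.logb 2 (1 / laplaceSmooth f x) := by
  refine ⟨hf.integrable.aestronglyMeasurable.mul
    (continuous_logb_laplaceSmooth hf).aestronglyMeasurable, ?_⟩
  rw [hasFiniteIntegral_iff_ofReal (ae_of_all _ fun x =>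
    mul_nonneg (hf.nonneg x) (logb_one_div_laplaceSmooth_nonneg hf x)), ← setLIntegral_univ,
    ← iUnion_cell one_pos, lintegral_iUnion (fun _ => measurableSet_Ioc) (pairwise_disjoint_cell 1)]
  refine (ENNReal.tsum_le_tsum fun j => setLIntegral_mul_logb_laplaceSmooth_le hf j).trans_lt ?_
  rw [ENNReal.tsum_add, ENNReal.tsum_mul_left, tsum_cellProb hf one_pos, mul_one]
  exact ENNReal.add_lt_top.2 ⟨hH.lt_top, ENNReal.ofReal_lt_top⟩

/-- The differential entropy is finite if the entropy of a grid is finite and the negative part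
of its integrand is integrable. -/
lemma integrable_mul_logb (hH : gridEntropy f 1 ≠ ⊤)
    (hneg : ∫⁻ x, ENNReal.ofReal (-(f x * Real.logb 2 (1 / f x))) ≠ ⊤) :
    Integrable fun x => f x * Real.logb 2 (1 / f x) := by
  have hm : AEStronglyMeasurable (fun x => f x * Real.logb 2 (1 / f x)) volume := by
    have h := hf.integrable.aestronglyMeasurable.aemeasurable
    exact (h.mul ((Real.measurable_log.comp_aemeasurable
      (aemeasurable_const.div h)).div_const _)).aestronglyMeasurable
  have hi : Integrable fun x => f x * Real.logb 2 (1 / laplaceSmooth f x) +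
      laplaceSmooth f x / Real.log 2 := (integrable_mul_logb_laplaceSmooth hf hH).add
    ((integrable_laplaceSmooth hf).div_const (Real.log 2))
  refine ⟨hm, ?_⟩
  -- The pointwise Gibbs inequality relative to the smoothing bounds the positive part; the negative
  -- part is controlled by hypothesis.
  have hle : ∀ x, ‖f x * Real.logb 2 (1 / f x)‖ₑ ≤
      ENNReal.ofReal (-(f x * Real.logb 2 (1 / f x))) +
        ENNReal.ofReal (f x * Real.logb 2 (1 / laplaceSmooth f x) +
          laplaceSmooth f x / Real.log 2) := by
    intro x
    have h1 := mul_logb_le 1 (hf.nonneg x) (laplaceSmooth_pos hf x) one_pos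
    have h2 : 0 ≤ f x / Real.log 2 := div_nonneg (hf.nonneg x) (Real.log_pos one_lt_two).le
    rw [mul_one, sub_div] at h1
    rw [Real.enorm_eq_ofReal_abs]
    rcases abs_cases (f x * Real.logb 2 (1 / f x)) with ⟨h, _⟩ | ⟨h, _⟩ <;> rw [h]
    · exact (ENNReal.ofReal_le_ofReal (by linarith)).trans le_add_self
    · exact le_self_add
  refine (lintegral_mono hle).trans_lt ?_
  rw [lintegral_add_right' _ hi.aestronglyMeasurable.aemeasurable.ennreal_ofReal]
  exact ENNReal.add_lt_top.2 ⟨hneg.lt_top, hi.lintegral_lt_top⟩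

end

/-! ### The entropy of fine grids -/

section
variable {f : ℝ → ℝ}

/-- The entropy of a grid is bounded by the cross entropy relative to a function `q` that varies
slowly at the scale of the grid. -/
lemma gridEntropy_le_of_slowly_varying (hf : IsDensity f) {q G : ℝ → ℝ} {ε ρ : ℝ} (hε : 0 < ε)
    (hρ : 0 < ρ) (hq : ∀ x, 0 < q x) (hqi : Integrable q) (hGi : Integrable G)
    (hG : ∀ x, f x * Real.logb 2 (1 / q x) ≤ G x)
    (hslow : ∀ x y, |x - y| ≤ 2 * ε → q x ≤ ρ * q y) :
    ∃ T : ℝ, 0 ≤ T ∧ gridEntropy f ε ≤ ENNReal.ofReal T ∧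
      T = Real.logb 2 (1 / (2 * ε)) + Real.logb 2 ρ + (∫ x, G x) +
        (ρ * (∫ x, q x) - 1) / Real.log 2 := by
  obtain ⟨D, hD⟩ : ∃ D, D = Real.logb 2 (1 / (2 * ε)) + Real.logb 2 ρ := ⟨_, rfl⟩
  have hlog := Real.log_pos one_lt_two
  have i1 : Integrable fun x => f x * D + G x := (hf.integrable.mul_const D).add hGi
  have i2 : Integrable fun x => (ρ * q x - f x) / Real.log 2 :=
    ((hqi.const_mul ρ).sub hf.integrable).div_const _
  have i3 : Integrable fun x => f x * D + G x + (ρ * q x - f x) / Real.log 2 := i1.add i2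
  have hcell : ∀ j : ℤ, cellProb f ε j * Real.logb 2 (1 / cellProb f ε j) ≤
      ∫ x in Ioc (2 * ε * j) (2 * ε * (j + 1)), (f x * D + G x + (ρ * q x - f x) / Real.log 2) := by
    intro j
    have hvol : volume.real (Ioc (2 * ε * (j : ℝ)) (2 * ε * (j + 1))) = 2 * ε := by
      rw [Real.volume_real_Ioc_of_le (by nlinarith)]
      ring
    have hnear : ∀ x ∈ Ioc (2 * ε * (j : ℝ)) (2 * ε * (j + 1)), |x - 2 * ε * j| ≤ 2 * ε := by
      intro x hx
      rw [abs_le]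
      constructor <;> linarith [hx.1, hx.2]
    have hQ := hq (2 * ε * j)
    -- The comparison mass of a cell is its length times q at its left end; slow variation replaces
    -- that value by q x at the price of ρ, both in the logarithm (`e1`) and in the linear term
    -- (`e2`).
    have hgibbs := mul_logb_le 1 (cellProb_nonneg hf hε j)
      (show 0 < 2 * ε * q (2 * ε * j) by positivity) one_pos
    have e1 : cellProb f ε j * Real.logb 2 (1 / (2 * ε * q (2 * ε * j))) ≤
        ∫ x in Ioc (2 * ε * j) (2 * ε * (j + 1)), (f x * D + G x) := by
      rw [cellProb_eq hf hε, ← integral_mul_const]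
      refine setIntegral_mono_on (hf.integrable.integrableOn.mul_const _) i1.integrableOn
        measurableSet_Ioc fun x hx => ?_
      have hqx := hq x
      have h1 : Real.logb 2 (1 / (2 * ε * q (2 * ε * j))) ≤ D + Real.logb 2 (1 / q x) := by
        rw [hD, ← Real.logb_mul (by positivity) (by positivity),
          ← Real.logb_mul (by positivity) (by positivity)]
        refine Real.logb_le_logb_of_le one_lt_two (by positivity) ?_
        have := hslow x _ (hnear x hx)
        rw [show 1 / (2 * ε) * ρ * (1 / q x) = ρ / (2 * ε * q x) by field_simp,
          div_le_div_iff₀ (by positivity) (by positivity)]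
        nlinarith
      have h2 := mul_le_mul_of_nonneg_left h1 (hf.nonneg x)
      have h3 := hG x
      linarith
    have e2 : (2 * ε * q (2 * ε * j) * 1 - cellProb f ε j) / Real.log 2 ≤
        ∫ x in Ioc (2 * ε * j) (2 * ε * (j + 1)), (ρ * q x - f x) / Real.log 2 := by
      rw [integral_div, integral_sub (hqi.const_mul ρ).integrableOn hf.integrable.integrableOn,
        ← cellProb_eq hf hε, mul_one]
      gcongr
      have : ∫ x in Ioc (2 * ε * (j : ℝ)) (2 * ε * (j + 1)), q (2 * ε * j) =
          2 * ε * q (2 * ε * j) := by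
        rw [setIntegral_const, hvol, smul_eq_mul]
      rw [← this]
      refine setIntegral_mono_on (integrableOn_const (by simp)) (hqi.const_mul ρ).integrableOn
        measurableSet_Ioc fun x hx => hslow _ _ ?_
      rw [abs_sub_comm]
      exact hnear x hx
    rw [integral_add i1.integrableOn i2.integrableOn]
    linarith
  have hpos : ∀ j : ℤ, 0 ≤ cellProb f ε j * Real.logb 2 (1 / cellProb f ε j) := fun j =>
    mul_nonneg (cellProb_nonneg hf hε j) (logb_one_div_cellProb_nonneg hf hε j)
  have hsum : HasSum (fun j : ℤ => ∫ x in Ioc (2 * ε * (j : ℝ)) (2 * ε * (j + 1)),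
      (f x * D + G x + (ρ * q x - f x) / Real.log 2))
      (∫ x, (f x * D + G x + (ρ * q x - f x) / Real.log 2)) := by
    have := hasSum_integral_iUnion (fun j : ℤ => measurableSet_Ioc) (pairwise_disjoint_cell ε)
      (i3.integrableOn (s := ⋃ j : ℤ, Ioc (2 * ε * (j : ℝ)) (2 * ε * (j + 1))))
    rwa [iUnion_cell hε, setIntegral_univ] at this
  refine ⟨_, hsum.nonneg fun j => (hpos j).trans (hcell j), ?_, ?_⟩
  · rw [← hsum.tsum_eq, ENNReal.ofReal_tsum_of_nonneg (fun j => (hpos j).trans (hcell j))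
      hsum.summable]
    exact ENNReal.tsum_le_tsum fun j => ENNReal.ofReal_le_ofReal (hcell j)
  · rw [integral_add i1 i2, integral_add (hf.integrable.mul_const D) hGi, integral_mul_const,
      integral_div, integral_sub (hqi.const_mul ρ) hf.integrable, integral_const_mul,
      hf.integral_eq_one, one_mul, hD]

/-- The sum of a compactly supported continuous function and a Laplace smoothing varies slowly
at small scales. -/
lemma exists_slowly_varying (hf : IsDensity f) {ψ : ℝ → ℝ} (hψ : Continuous ψ)
    (hsupp : HasCompactSupport ψ) (h0 : ∀ x, 0 ≤ ψ x) :
    ∃ δ > 0, ∀ x y, |x - y| ≤ δ → (ψ x + laplaceSmooth f x) / 2 ≤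
      11 / 10 * ((ψ y + laplaceSmooth f y) / 2) := by
  -- Near the support of ψ the smoothing is at least some c > 0, so an oscillation c / 20 of ψ is
  -- absorbed by a twentieth of the smoothing. The smoothing itself varies by a factor at most
  -- 21/20, which gives 22/20 = 11/10 in total.
  have hK : IsCompact (Metric.cthickening 1 (tsupport ψ)) := hsupp.isCompact.cthickening
  obtain ⟨c, hc, hcK⟩ := hK.exists_forall_le' (continuous_laplaceSmooth hf).continuousOn
    (a := 0) fun x _ => laplaceSmooth_pos hf x
  obtain ⟨δ, hδ, hu⟩ := Metric.uniformContinuous_iff.1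
    (hsupp.uniformContinuous_of_continuous hψ) (c / 20) (by positivity)
  refine ⟨min (δ / 2) (1 / 25), by positivity, fun x y hxy => ?_⟩
  have hx1 : |x - y| ≤ δ / 2 := hxy.trans (min_le_left _ _)
  have hx2 : |x - y| ≤ 1 / 25 := hxy.trans (min_le_right _ _)
  have hl := laplaceSmooth_le hf x y
  have hly := laplaceSmooth_pos hf y
  have hexp : Real.exp |x - y| ≤ 21 / 20 := by
    have h1 : Real.exp |x - y| ≤ Real.exp (1 / 25) := Real.exp_le_exp.2 hx2
    have h2 := Real.one_sub_le_exp_neg (1 / 25)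
    rw [Real.exp_neg] at h2
    have h3 := (Real.exp_pos (1 / 25))
    have h4 : (1 - 1 / 25) * Real.exp (1 / 25) ≤ 1 := by
      calc _ ≤ (Real.exp (1 / 25))⁻¹ * Real.exp (1 / 25) := by gcongr
        _ = 1 := inv_mul_cancel₀ h3.ne'
    linarith
  have hψxy : ψ x ≤ ψ y + laplaceSmooth f y / 20 := by
    by_cases hz : ψ x = 0
    · rw [hz]
      have := h0 y
      positivity
    · have hy : y ∈ Metric.cthickening 1 (tsupport ψ) := by
        refine Metric.mem_cthickening_of_dist_le y x 1 _ (subset_tsupport _ hz) ?_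
        rw [dist_comm, Real.dist_eq]
        linarith
      have h1 := hu (a := x) (b := y) (by rw [Real.dist_eq]; linarith)
      rw [Real.dist_eq] at h1
      have h2 := hcK y hy
      linarith [le_abs_self (ψ x - ψ y)]
  have := mul_le_mul_of_nonneg_right hexp hly.le
  have := h0 y
  linarith

/-- The law of the set on which a function is less than half of the density. -/
lemma law_lt_half_le (hf : IsDensity f) {ψ : ℝ → ℝ} (hψ : Integrable ψ) :
    law f {x | ψ x < f x / 2} ≤ 2 * ∫⁻ x, ‖f x - ψ x‖ₑ := by
  have hB : NullMeasurableSet {x | ψ x < f x / 2} :=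
    nullMeasurableSet_lt hψ.aestronglyMeasurable.aemeasurable
      (hf.integrable.aestronglyMeasurable.aemeasurable.div_const 2)
  rw [law, withDensity_apply', ← lintegral_indicator₀ hB, ← lintegral_const_mul' _ _ (by simp)]
  refine lintegral_mono fun x => ?_
  by_cases hx : ψ x < f x / 2
  · rw [indicator_of_mem (show x ∈ {x | ψ x < f x / 2} from hx), Real.enorm_eq_ofReal_abs,
      ← ENNReal.ofReal_ofNat 2, ← ENNReal.ofReal_mul (by norm_num)]
    refine ENNReal.ofReal_le_ofReal ?_
    -- Where ψ < f / 2, one has f < 2 (f - ψ).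
    linarith [le_abs_self (f x - ψ x)]
  · rw [indicator_of_notMem (show x ∉ {x | ψ x < f x / 2} from hx)]
    exact zero_le

/-- A density of finite entropy has arbitrarily small mass, weighted by an integrable factor, where
a good approximation is less than half of it. -/
lemma exists_approx (hf : IsDensity f) {γ : ℝ → ℝ} (hγm : AEMeasurable γ)
    (hγ : Integrable fun x => f x * γ x) {s : ℝ} (hs : 0 < s) (hγ0 : ∀ x, 0 ≤ γ x) :
    ∃ ψ : ℝ → ℝ, Continuous ψ ∧ HasCompactSupport ψ ∧ (∀ x, 0 ≤ ψ x) ∧ Integrable ψ ∧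
      ∫ x, ψ x ≤ 1 + 1 / 10 ∧ ∫ x in {x | ψ x < f x / 2}, f x * γ x ≤ s := by
  have hnn : ∀ x, 0 ≤ f x * γ x := fun x => mul_nonneg (hf.nonneg x) (hγ0 x)
  have hset : ∀ B : Set ℝ, ∫⁻ x in B, ENNReal.ofReal (γ x) ∂(law f) =
      ∫⁻ x in B, ENNReal.ofReal (f x * γ x) := by
    intro B
    rw [law, restrict_withDensity', lintegral_withDensity_eq_lintegral_mul₀
      hf.aemeasurable_ofReal.restrict hγm.ennreal_ofReal.restrict]
    refine lintegral_congr fun x => ?_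
    rw [Pi.mul_apply, ENNReal.ofReal_mul (hf.nonneg x)]
  have hfin : ∫⁻ x, ENNReal.ofReal (γ x) ∂(law f) ≠ ⊤ := by
    rw [← setLIntegral_univ, hset, setLIntegral_univ]
    exact hγ.lintegral_lt_top.ne
  -- Absolute continuity of the integral of γ with respect to the law; an L¹-close ψ makes the law
  -- of the bad set small enough.
  obtain ⟨δ, hδ, hsmall⟩ := exists_pos_setLIntegral_lt_of_measure_lt hfin
    (ENNReal.ofReal_pos.2 hs).ne'
  obtain ⟨δ', hδ'0, hδ'⟩ : ∃ δ' : ℝ, 0 < δ' ∧ ENNReal.ofReal (2 * δ') < δ := by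
    obtain ⟨r, hr0, hr⟩ := ENNReal.lt_iff_exists_real_btwn.1 hδ
    refine ⟨r / 2, ?_, by rw [mul_div_cancel₀ _ two_ne_zero]; exact hr.2⟩
    have := ENNReal.ofReal_pos.1 hr.1
    positivity
  obtain ⟨ψ, hsupp, hdist, hcont, hint⟩ := hf.integrable.exists_hasCompactSupport_integral_sub_le
    (show 0 < min δ' (1 / 10) by positivity)
  have hint' : Integrable fun x => max (ψ x) 0 := hint.pos_part
  have hd : Integrable fun x => f x - ψ x := hf.integrable.sub hint
  have hd' : Integrable fun x => f x - max (ψ x) 0 := hf.integrable.sub hint'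
  have hpt : ∀ x, ‖f x - max (ψ x) 0‖ ≤ ‖f x - ψ x‖ := by
    intro x
    have := hf.nonneg x
    rw [Real.norm_eq_abs, Real.norm_eq_abs]
    grind
  have hle : ∫ x, ‖f x - max (ψ x) 0‖ ≤ min δ' (1 / 10) :=
    (integral_mono hd'.norm hd.norm hpt).trans hdist
  refine ⟨fun x => max (ψ x) 0, hcont.max continuous_const, ?_, fun x => le_max_right _ _, hint',
    ?_, ?_⟩
  · exact hsupp.comp_left (g := fun z : ℝ => max z 0) (by simp)
  · have h1 : ∫ x, max (ψ x) 0 ≤ ∫ x, (f x + ‖f x - max (ψ x) 0‖) := by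
      refine integral_mono hint' (hf.integrable.add hd'.norm) fun x => ?_
      simp only [Real.norm_eq_abs]
      linarith [neg_abs_le (f x - max (ψ x) 0)]
    rw [integral_add hf.integrable hd'.norm, hf.integral_eq_one] at h1
    linarith [hle.trans (min_le_right _ _)]
  · have hB : law f {x | max (ψ x) 0 < f x / 2} < δ := by
      refine (law_lt_half_le hf hint').trans_lt (lt_of_le_of_lt ?_ hδ')
      rw [← ofReal_integral_norm_eq_lintegral_enorm hd', ENNReal.ofReal_mul zero_le_two,
        ENNReal.ofReal_ofNat]
      gcongr
      exact hle.trans (min_le_left _ _)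
    have h1 := (hsmall _ hB).le
    rw [hset, ← ofReal_integral_eq_lintegral_ofReal hγ.integrableOn (ae_of_all _ hnn)] at h1
    exact (ENNReal.ofReal_le_ofReal_iff hs.le).1 h1

lemma exists_slowly_varying_majorant (hf : IsDensity f) (hH : gridEntropy f 1 ≠ ⊤)
    (hi : Integrable fun x => f x * Real.logb 2 (1 / f x)) :
    ∃ q G : ℝ → ℝ, (∀ x, 0 < q x) ∧ Integrable q ∧ Integrable G ∧
      (∀ x, f x * Real.logb 2 (1 / q x) ≤ G x) ∧ ∫ x, q x ≤ 21 / 20 ∧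
      ∫ x, G x ≤ (∫ x, f x * Real.logb 2 (1 / f x)) + 2 + 1 / 2 ∧
      ∃ δ > 0, ∀ x y, |x - y| ≤ δ → q x ≤ 11 / 10 * q y := by
  have hfm := hf.integrable.aestronglyMeasurable.aemeasurable
  have hlm : AEMeasurable fun x => Real.logb 2 (1 / f x) :=
    (Real.measurable_log.comp_aemeasurable (aemeasurable_const.div hfm)).div_const _
  -- The first two terms bound log₂(1 / q) where ψ is a bad approximation; the absolute value
  -- offsets f log₂(1 / f), which stays in G there and may be negative.
  set γ : ℝ → ℝ := fun x =>
    Real.logb 2 (1 / laplaceSmooth f x) + 1 + |Real.logb 2 (1 / f x)| with hγdef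
  have hγm : AEMeasurable γ :=
    ((continuous_logb_laplaceSmooth hf).aemeasurable.add_const 1).add hlm.abs
  have hγ0 : ∀ x, 0 ≤ γ x := fun x => by
    have := logb_one_div_laplaceSmooth_nonneg hf x
    positivity
  have hγi : Integrable fun x => f x * γ x := by
    refine (((integrable_mul_logb_laplaceSmooth hf hH).add hf.integrable).add hi.abs).congr
      (ae_of_all _ fun x => ?_)
    simp only [hγdef, Pi.add_apply, abs_mul, abs_of_nonneg (hf.nonneg x)]
    ring
  obtain ⟨ψ, hψc, hψs, hψ0, hψi, hψ1, hψB⟩ := exists_approx hf hγm hγi one_half_pos hγ0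
  obtain ⟨δ, hδ, hslow⟩ := exists_slowly_varying hf hψc hψs hψ0
  have hB : NullMeasurableSet {x | ψ x < f x / 2} :=
    nullMeasurableSet_lt hψi.aestronglyMeasurable.aemeasurable (hfm.div_const 2)
  have i1 : Integrable fun x => f x * Real.logb 2 (1 / f x) + 2 * f x :=
    hi.add (hf.integrable.const_mul 2)
  have i2 : Integrable ({x | ψ x < f x / 2}.indicator fun x => f x * γ x) := hγi.indicator₀ hB
  -- Off the bad set q ≥ f / 4, a loss of two bits; on it q is at least half of the smoothing, a
  -- loss of one bit that γ includes. The integral of q is at most (11/10 + 1) / 2.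
  refine ⟨fun x => (ψ x + laplaceSmooth f x) / 2, fun x => f x * Real.logb 2 (1 / f x) + 2 * f x +
    {x | ψ x < f x / 2}.indicator (fun x => f x * γ x) x, fun x => ?_,
    (hψi.add (integrable_laplaceSmooth hf)).div_const 2, i1.add i2, fun x => ?_, ?_, ?_, δ, hδ,
    hslow⟩
  · have := hψ0 x
    have := laplaceSmooth_pos hf x
    positivity
  · have h1 := hψ0 x
    have h2 := laplaceSmooth_pos hf x
    beta_reduce
    rcases (hf.nonneg x).eq_or_lt with h | h
    · by_cases hx : x ∈ {x | ψ x < f x / 2} <;> simp [indicator, ← h]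
    by_cases hx : ψ x < f x / 2
    · rw [indicator_of_mem (show x ∈ {x | ψ x < f x / 2} from hx)]
      have h3 : Real.logb 2 (1 / ((ψ x + laplaceSmooth f x) / 2)) ≤
          Real.logb 2 (1 / laplaceSmooth f x) + 1 := by
        refine (Real.logb_le_logb_of_le (y := 1 / laplaceSmooth f x * 2) one_lt_two
          (by positivity) ?_).trans_eq (by
            rw [Real.logb_mul (by positivity) two_ne_zero, Real.logb_self_eq_one one_lt_two])
        rw [one_div_div, one_div_mul_eq_div]
        gcongr
        linarith
      have h4 := mul_le_mul_of_nonneg_left h3 h.le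
      have h5 := mul_le_mul_of_nonneg_left (neg_abs_le (Real.logb 2 (1 / f x))) h.le
      simp only [hγdef]
      nlinarith
    · rw [indicator_of_notMem (show x ∉ {x | ψ x < f x / 2} from hx), add_zero]
      have h3 : Real.logb 2 (1 / ((ψ x + laplaceSmooth f x) / 2)) ≤ Real.logb 2 (1 / f x) + 2 := by
        have h4 : Real.logb 2 4 = 2 := by
          rw [show (4 : ℝ) = 2 ^ (2 : ℝ) by norm_num]
          exact Real.logb_rpow two_pos (by norm_num)
        refine (Real.logb_le_logb_of_le (y := 1 / f x * 4) one_lt_two (by positivity) ?_).trans_eq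
          (by rw [Real.logb_mul (by positivity) (by norm_num), h4])
        rw [one_div_div, one_div_mul_eq_div, div_le_div_iff₀ (by positivity) h]
        linarith
      nlinarith
  · rw [integral_div, integral_add hψi (integrable_laplaceSmooth hf), integral_laplaceSmooth hf]
    linarith
  · rw [integral_add i1 i2, integral_add hi (hf.integrable.const_mul 2), integral_const_mul,
      hf.integral_eq_one, integral_indicator₀ hB, mul_one]
    linarith

/-- The entropy of a fine grid is at most `log₂ (1 / ε)` plus the differential entropy plus two. -/
lemma eventually_gridEntropy_le (hf : IsDensity f) (hH : gridEntropy f 1 ≠ ⊤)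
    (hi : Integrable fun x => f x * Real.logb 2 (1 / f x)) :
    ∀ᶠ ε in 𝓝[>] (0 : ℝ), ((3 + gridEntropy f ε : ℝ≥0∞) : EReal) ≤
      ((Real.logb 2 (1 / ε) + (∫ x, f x * Real.logb 2 (1 / f x)) + 5 : ℝ) : EReal) := by
  obtain ⟨q, G, hq, hqi, hGi, hG, hq1, hG1, δ, hδ, hslow⟩ := exists_slowly_varying_majorant hf hH hi
  filter_upwards [Ioo_mem_nhdsGT (show 0 < δ / 2 by positivity)] with ε hε
  obtain ⟨T, hT0, hT, hTeq⟩ := gridEntropy_le_of_slowly_varying hf hε.1 (by norm_num) hq hqi hGi hG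
    fun x y hxy => hslow x y (by linarith [hε.2])
  have hle : 3 + gridEntropy f ε ≤ ENNReal.ofReal (3 + T) := by
    rw [ENNReal.ofReal_add (by norm_num) hT0, ENNReal.ofReal_ofNat]
    gcongr
  refine (EReal.coe_ennreal_le_coe_ennreal_iff.2 hle).trans ?_
  rw [EReal.coe_ennreal_ofReal, max_eq_left (by linarith), EReal.coe_le_coe_iff, hTeq]
  -- Beyond log₂(1 / ε) and the differential entropy, the losses are -1 + 1/5 + 5/2 + 1/4 = 1.95 ≤
  -- 2.
  have hl := Real.log_two_gt_d9
  have h1 : Real.logb 2 (1 / (2 * ε)) = Real.logb 2 (1 / ε) - 1 := by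
    have := hε.1
    rw [one_div, one_div, Real.logb_inv, Real.logb_inv, Real.logb_mul two_ne_zero this.ne',
      Real.logb_self_eq_one one_lt_two]
    ring
  have h2 : Real.logb 2 (11 / 10) ≤ 1 / 5 := by
    have := Real.log_le_sub_one_of_pos (show (0 : ℝ) < 11 / 10 by norm_num)
    rw [Real.logb, div_le_iff₀ (Real.log_pos one_lt_two)]
    linarith
  have h3 : (11 / 10 * (∫ x, q x) - 1) / Real.log 2 ≤ 1 / 4 := by
    rw [div_le_iff₀ (Real.log_pos one_lt_two)]
    linarith
  linarith

end

end VonNeumann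

open MeasureTheory Filter Topology VonNeumann in
theorem theorem4 (f g : ℝ → ℝ) (hf : IsDensity f) (hg : IsDensity g)
    (hC : ∃ C : ℝ, ∀ x, f x ≤ C * g x)
    (hR : RiemannIntegrableUnit (transformed f g)) :
    (∀ ε : ℝ, 0 < ε → expectedBisectionBits f g ε ≤ 3 + gridEntropy f ε) ∧
    (gridEntropy f 1 ≠ ⊤ →
      ∫⁻ x, ENNReal.ofReal (-(f x * Real.logb 2 (1 / f x))) ≠ ⊤ →
      Integrable (fun x => f x * Real.logb 2 (1 / f x)) ∧
      ∃ r : ℝ → ℝ, Tendsto r (𝓝[>] 0) (𝓝 0) ∧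
        ∀ᶠ ε in 𝓝[>] (0 : ℝ),
          (expectedBisectionBits f g ε : EReal) ≤
            ((Real.logb 2 (1 / ε) + (∫ x, f x * Real.logb 2 (1 / f x)) + 5 + r ε : ℝ) : EReal) ∧
          ((3 + gridEntropy f ε : ENNReal) : EReal) ≤
            ((Real.logb 2 (1 / ε) + (∫ x, f x * Real.logb 2 (1 / f x)) + 5 + r ε : ℝ) : EReal)) := by
  have hbits : ∀ ε : ℝ, 0 < ε → expectedBisectionBits f g ε ≤ 3 + gridEntropy f ε :=
    fun ε hε => expectedBisectionBits_le_gridEntropy hf hg hC hε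
  refine ⟨hbits, fun hH hneg => ?_⟩
  have hi := integrable_mul_logb hf hH hneg
  -- The slack in the constant 5 makes the bound hold for all small ε with error term 0.
  refine ⟨hi, fun _ => 0, tendsto_const_nhds, ?_⟩
  filter_upwards [eventually_gridEntropy_le hf hH hi, self_mem_nhdsWithin] with ε h hε
  rw [add_zero]
  exact ⟨(EReal.coe_ennreal_le_coe_ennreal_iff.2 (hbits ε hε)).trans h, h⟩
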